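/- **Definitions.** Let $K$ be a finite simplicial complex. A *Morse tile* $T$ of order $k$ is an $n$-simplex $\overline{T}$ deprived of $k$ of its facets ($0\le k\le n+1$) and, if $k\ge 1$, of one possibly empty face $\mu$ of codimension at least two (if $\mu$ is non-empty, it is taken not to lie in any of the removed facets, as otherwise its removal has no effect). The tile is *critical* if $\dim\mu=k-1$ (where $\dim\emptyset=-1$, so that closed simplices are critical) or if it is an open simplex ($k=n+1$). A *Morse tiling* of $K$ is a partition of the geometric realization $|K|$ into Morse tiles whose underlying simplices belong to $K$, such that for every $j\ge 0$ the union of the tiles of dimension greater than $j$ is closed. Its quiver has the tiles as vertices and an arrow $T\to T'$, for $T\ne T'$, whenever $\overline{T}\cap T'\neq\emptyset$; this arrow is labelled by $\dim(\overline{T}\cap\overline{T'})$. The Morse tiled complex is *shellable up to order* $q\ge 0$ if its quiver has no oriented cycle all of whose arrows have labels $\le q$. Let $K^{(q)}$ be the $q$-skeleton of $K$. A *partial shelling* is a sequence of distinct tiles $T_1,\dots,T_N$ of order $\le q+1$ of the tiling such that, with $S_p=T_1\cup\dots\cup T_p$, each $S_p\cap K^{(q)}$ is closed in $K^{(q)}$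 and $S_N\cap K^{(q)}=K^{(q)}$. Write $K_p$ for the subcomplex of $K^{(q)}$ with realization $S_p\cap K^{(q)}$, so that $\emptyset=K_0\subset K_1\subset\dots\subset K_N=K^{(q)}$; set $K_p=\emptyset$ for $p<0$ and $K_p=K^{(q)}$ for $p>N$. **Theorem 4.1.** Let $K$ be a finite simplicial complex with a Morse tiling that is shellable up to order $q\ge 0$, let $T_1,\dots,T_N$ be any partial shelling of it, and let $G$ be an abelian group. 1. The spectral sequence $(E^r_{p,s},d^r)_{r\ge 0}$, with $d^r$ of bidegree $(-r,r-1)$, of the simplicial chain complex $C_*(K^{(q)};G)$ filtered by the subcomplexes $C_*(K_p;G)$ converges to $H_*(K^{(q)};G)$: for $r\ge N$ one has $d^r=0$ and $$E^r_{p,n-p}\cong H_n(K^{(q)};G)_p/H_n(K^{(q)};G)_{p-1},$$ where $H_n(K^{(q)};G)_p$ is the image of $H_n(K_p;G)$, a finite filtration of $H_n(K^{(q)};G)$. In total degrees $n<q$, its first page is the relative homology of the critical tiles: for $1\le p\le N$ the group $E^1_{p,n-p}$ is isomorphic to $H_n(\overline{T_p},\overline{T_p}\setminus T_p;G)$ if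 $T_p$ is critical and vanishes otherwise; $E^1_{p,n-p}=0$ for $p\notin\{1,\dots,N\}$ (in every degree $n$); and $H_n(\overline{T},\overline{T}\setminus T;G)=0$ for every critical tile $T$ of the tiling that is not among $T_1,\dots,T_N$. 2. The spectral sequence $(E_r^{p,s},d_r)_{r\ge 0}$, with $d_r$ of bidegree $(r,1-r)$, of the simplicial cochain complex $C^*(K^{(q)};G)$ filtered by the subcomplexes $C^*(K^{(q)},K_p;G)$ converges to $H^*(K^{(q)};G)$: for $r\ge N$ one has $d_r=0$ and $$E_r^{p,n-p}\cong H^n(K^{(q)};G)_p/H^n(K^{(q)};G)_{p+1},$$ where $H^n(K^{(q)};G)_p$ is the image of $H^n(K^{(q)},K_p;G)$, a finite filtration of $H^n(K^{(q)};G)$. In total degrees $n<q$, its first page is the relative cohomology of the critical tiles: for $0\le p\le N-1$ the group $E_1^{p,n-p}$ is isomorphic to $H^n(\overline{T_{p+1}},\overline{T_{p+1}}\setminus T_{p+1};G)$ if $T_{p+1}$ is critical and vanishes otherwise; $E_1^{p,n-p}=0$ for $p\notin\{0,\dots,N-1\}$ (in every degree $n$); and $H^n(\overline{T},\overline{T}\setminus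 T;G)=0$ for every critical tile $T$ of the tiling that is not among $T_1,\dots,T_N$. -/

import Mathlib

open CategoryTheory CategoryTheory.Limits

universe u v

namespace MorseTiled

noncomputable section

/-! ### Finite simplicial complexes and their geometric realization -/

section Realization

variable {V : Type u} [Fintype V]

/-- The closed geometric simplex spanned by the vertices `s`: the points of the standard simplex
whose barycentric coordinates vanish outside `s` (empty if `s` is empty). -/
def closedSimplex (s : Finset V) : Set (V → ℝ) :=
  {x | x ∈ stdSimplex ℝ V ∧ ∀ w, w ∉ s → x w = 0}

/-- The geometric realization of a simplicial complex on the finite vertex set `V`. -/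
def realization (K : PreAbstractSimplicialComplex V) : Set (V → ℝ) :=
  ⋃ s ∈ K.faces, closedSimplex s

/-- `U` is (a subset of `S`) closed in the subspace `S`. -/
def IsClosedIn (S U : Set (V → ℝ)) : Prop :=
  U ⊆ S ∧ IsClosed ((↑) ⁻¹' U : Set S)

/-- The `q`-skeleton: the simplices of dimension at most `q`. -/
def skeleton (K : PreAbstractSimplicialComplex V) (q : ℕ) : PreAbstractSimplicialComplex V where
  faces := {s | s ∈ K.faces ∧ s.card ≤ q + 1}
  isRelLowerSet_faces := by
    intro s hs
    refine ⟨(K.isRelLowerSet_faces hs.1).1, fun t hts ht => ?_⟩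
    exact ⟨(K.isRelLowerSet_faces hs.1).2 hts ht, (Finset.card_le_card hts).trans hs.2⟩

/-- The largest subcomplex of `K` whose realization is contained in the set `U`. (If `U` is a
closed union of open simplices of `K`, its realization is `U`.) -/
def subcomplexIn (K : PreAbstractSimplicialComplex V) (U : Set (V → ℝ)) :
    PreAbstractSimplicialComplex V where
  faces := {s | s ∈ K.faces ∧ closedSimplex s ⊆ U}
  isRelLowerSet_faces := by
    intro s hs
    refine ⟨(K.isRelLowerSet_faces hs.1).1, fun t hts ht => ?_⟩
    refine ⟨(K.isRelLowerSet_faces hs.1).2 hts ht, fun x hx => hs.2 ?_⟩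
    exact ⟨hx.1, fun w hw => hx.2 w fun hwt => hw (hts hwt)⟩

theorem subcomplexIn_le (K : PreAbstractSimplicialComplex V) (U : Set (V → ℝ)) :
    subcomplexIn K U ≤ K := fun _ hs => hs.1

end Realization

/-! ### Simplicial chains and cochains

A linear order on the vertices orients every simplex. -/

section Chains

variable {V : Type u} [LinearOrder V]

/-- The incidence number of `s` and `t`: the coefficient of `t` in
`∂ [v₀ < ⋯ < vₙ] = ∑ᵢ (-1)ⁱ [v₀, …, v̂ᵢ, …, vₙ]`. -/
def incidence (s t : Finset V) : ℤ :=
  ∑ w ∈ s, if s.erase w = t then (-1) ^ (s.filter (· < w)).card else 0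

theorem incidence_ne_zero {s t : Finset V} (h : incidence s t ≠ 0) :
    t ⊆ s ∧ s.card = t.card + 1 := by
  obtain ⟨w, hw, hne⟩ := Finset.exists_ne_zero_of_sum_ne_zero h
  have he : s.erase w = t := by
    by_contra hc
    simp [hc] at hne
  subst he
  exact ⟨Finset.erase_subset _ _, (Finset.card_erase_add_one hw).symm⟩

theorem incidence_erase {s : Finset V} {w : V} (hw : w ∈ s) :
    incidence s (s.erase w) = (-1) ^ (s.filter (· < w)).card := by
  unfold incidence
  rw [Finset.sum_eq_single w]
  · simp
  · intro b hb hbw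
    rw [if_neg]
    intro h
    have : b ∈ s.erase w := Finset.mem_erase.2 ⟨hbw, hb⟩
    rw [← h] at this
    simp at this
  · exact fun h => absurd hw h

theorem incidence_erase_erase {s : Finset V} {a b : V} (ha : a ∈ s) (hb : b ∈ s) (hab : a < b) :
    incidence s (s.erase a) * incidence (s.erase a) ((s.erase a).erase b) +
      incidence s (s.erase b) * incidence (s.erase b) ((s.erase b).erase a) = 0 := by
  rw [incidence_erase ha, incidence_erase hb,
    incidence_erase (Finset.mem_erase.2 ⟨hab.ne', hb⟩),
    incidence_erase (Finset.mem_erase.2 ⟨hab.ne, ha⟩)]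
  have h1 : (s.erase b).filter (· < a) = s.filter (· < a) := by
    ext x
    simp only [Finset.mem_filter, Finset.mem_erase]
    constructor
    · rintro ⟨⟨_, h⟩, h'⟩
      exact ⟨h, h'⟩
    · rintro ⟨h, h'⟩
      exact ⟨⟨(h'.trans hab).ne, h⟩, h'⟩
  have h2 : ((s.erase a).filter (· < b)).card + 1 = (s.filter (· < b)).card := by
    have : (s.erase a).filter (· < b) = (s.filter (· < b)).erase a := by
      ext x
      simp only [Finset.mem_filter, Finset.mem_erase]
      tauto
    rw [this, Finset.card_erase_add_one]
    simp [ha, hab]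
  rw [h1, ← h2]
  ring

theorem mem_of_incidence_ne_zero {L : PreAbstractSimplicialComplex V} {s t : Finset V}
    (hs : s ∈ L.faces) (ht : t.Nonempty) (h : incidence s t ≠ 0) : t ∈ L.faces :=
  (L.isRelLowerSet_faces hs).2 (incidence_ne_zero h).1 ht

variable [Fintype V]

/-- The simplices of `K` of dimension `n` (there are none if `n < 0`). -/
abbrev Face (K : PreAbstractSimplicialComplex V) (n : ℤ) : Type u :=
  {s : Finset V // s ∈ K.faces ∧ (s.card : ℤ) = n + 1}

instance instFintypeFace (K : PreAbstractSimplicialComplex V) (n : ℤ) : Fintype (Face K n) :=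
  Fintype.ofFinite _

/-- The boundary of a boundary vanishes, at the level of incidence numbers. -/
theorem sum_incidence (K : PreAbstractSimplicialComplex V) (j : ℤ) {s r : Finset V}
    (hs : s ∈ K.faces) (hr : r.Nonempty) (hrj : (r.card : ℤ) = j) :
    ∑ t : Face K j, incidence s t.1 * incidence t.1 r = 0 := by
  classical
  by_cases h : r ⊆ s ∧ s.card = r.card + 2
  · obtain ⟨hrs, hc⟩ := h
    have hd : (s \ r).card = 2 := by
      have := Finset.card_sdiff_add_card_eq_card hrs
      omega
    obtain ⟨a, b, hab, hsr⟩ : ∃ a b, a < b ∧ s \ r = {a, b} := by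
      obtain ⟨a, b, hne, h⟩ := Finset.card_eq_two.1 hd
      rcases lt_or_gt_of_ne hne with h' | h'
      · exact ⟨a, b, h', h⟩
      · exact ⟨b, a, h', by rw [h, Finset.pair_comm]⟩
    have hmem : ∀ x, x ∈ s ∧ x ∉ r ↔ x = a ∨ x = b := by
      intro x
      rw [← Finset.mem_sdiff, hsr]
      simp
    have ha := (hmem a).2 (Or.inl rfl)
    have hb := (hmem b).2 (Or.inr rfl)
    have hra : (s.erase a).erase b = r := by
      ext x
      have := hmem x
      have hx : x ∈ r → x ∈ s := fun h => hrs h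
      simp only [Finset.mem_erase]
      tauto
    have hrb : (s.erase b).erase a = r := by
      rw [Finset.erase_right_comm, hra]
    have face : ∀ w, w ∈ s → w ∉ r → s.erase w ∈ K.faces ∧ ((s.erase w).card : ℤ) = j + 1 := by
      intro w hw hwr
      refine ⟨(K.isRelLowerSet_faces hs).2 (Finset.erase_subset _ _) ?_, ?_⟩
      · obtain ⟨x, hx⟩ := hr
        exact ⟨x, Finset.mem_erase.2 ⟨fun h => hwr (h ▸ hx), hrs hx⟩⟩
      · have := Finset.card_erase_add_one hw
        omega
    have hne : (⟨s.erase a, face a ha.1 ha.2⟩ : Face K j) ≠ ⟨s.erase b, face b hb.1 hb.2⟩ := by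
      intro h
      have h' : s.erase a = s.erase b := congrArg Subtype.val h
      have : b ∈ s.erase a := Finset.mem_erase.2 ⟨hab.ne', hb.1⟩
      rw [h'] at this
      simp at this
    rw [Finset.sum_eq_add_of_mem _ _ (Finset.mem_univ _) (Finset.mem_univ _) hne]
    · have := incidence_erase_erase ha.1 hb.1 hab
      rwa [hra, hrb] at this
    · rintro ⟨t, ht⟩ - ⟨h1, h2⟩
      by_contra hcon
      obtain ⟨hi1, hi2⟩ := mul_ne_zero_iff.1 hcon
      have hts := incidence_ne_zero hi1
      have hrt := incidence_ne_zero hi2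
      obtain ⟨w, hw, hwt⟩ : ∃ w ∈ s, w ∉ t := by
        by_contra! hall
        have := Finset.card_le_card hall
        omega
      have hte : t = s.erase w := by
        apply Finset.eq_of_subset_of_card_le
        · exact fun x hx => Finset.mem_erase.2 ⟨fun h => hwt (h ▸ hx), hts.1 hx⟩
        · have := Finset.card_erase_add_one hw
          omega
      rcases (hmem w).1 ⟨hw, fun h => hwt (hrt.1 h)⟩ with rfl | rfl
      · exact h1 (Subtype.ext hte)
      · exact h2 (Subtype.ext hte)
  · apply Finset.sum_eq_zero
    intro t _
    by_contra hcon
    obtain ⟨hi1, hi2⟩ := mul_ne_zero_iff.1 hcon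
    have hts := incidence_ne_zero hi1
    have hrt := incidence_ne_zero hi2
    exact h ⟨hrt.1.trans hts.1, by omega⟩

variable (K L : PreAbstractSimplicialComplex V) (G : Type v) [AddCommGroup G]

/-- The boundary operator on chains `∑ c(s) s`; a chain of a finite complex is just the function
`c` of its coefficients. -/
def boundary (i j : ℤ) : (Face K i → G) →+ (Face K j → G) where
  toFun c := fun t => ∑ s : Face K i, incidence s.1 t.1 • c s
  map_zero' := by ext; simp
  map_add' a b := by ext; simp [Finset.sum_add_distrib]

/-- The coboundary operator on cochains `Hom(Cᵢ(K; ℤ), G)`, a cochain being given by its values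
on the simplices. -/
def coboundary (i j : ℤ) : (Face K i → G) →+ (Face K j → G) where
  toFun c := fun s => ∑ t : Face K i, incidence s.1 t.1 • c t
  map_zero' := by ext; simp
  map_add' a b := by ext; simp [Finset.sum_add_distrib]

/-- The simplicial chain complex of `K` with coefficients in `G`. -/
def chains : ChainComplex AddCommGrpCat.{max u v} ℤ where
  X n := AddCommGrpCat.of (Face K n → G)
  d i j := AddCommGrpCat.ofHom (boundary K G i j)
  shape i j hij := by
    refine AddCommGrpCat.hom_ext (AddMonoidHom.ext fun c => funext fun t => ?_)
    refine Finset.sum_eq_zero fun s _ => ?_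
    by_cases h : incidence s.1 t.1 = 0
    · simp [h]
    · exfalso
      apply hij
      have h1 := (incidence_ne_zero h).2
      have h2 := s.2.2
      have h3 := t.2.2
      simp only [ComplexShape.down_Rel]
      omega
  d_comp_d' i j k _ hjk := by
    refine AddCommGrpCat.hom_ext (AddMonoidHom.ext fun c => funext fun r => ?_)
    change ∑ t : Face K j, incidence t.1 r.1 • ∑ s : Face K i, incidence s.1 t.1 • c s = 0
    simp only [Finset.smul_sum, smul_smul]
    rw [Finset.sum_comm]
    refine Finset.sum_eq_zero fun s _ => ?_
    rw [← Finset.sum_smul]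
    have hk : ((r.1).card : ℤ) = j := by
      have h3 := r.2.2
      simp only [ComplexShape.down_Rel] at hjk
      omega
    have := sum_incidence K j s.2.1 (K.isRelLowerSet_faces r.2.1).1 hk
    simp only [mul_comm (incidence _ r.1)]
    rw [this, zero_smul]

/-- The simplicial cochain complex of `K` with coefficients in `G`. -/
def cochains : CochainComplex AddCommGrpCat.{max u v} ℤ where
  X n := AddCommGrpCat.of (Face K n → G)
  d i j := AddCommGrpCat.ofHom (coboundary K G i j)
  shape i j hij := by
    refine AddCommGrpCat.hom_ext (AddMonoidHom.ext fun c => funext fun s => ?_)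
    refine Finset.sum_eq_zero fun t _ => ?_
    by_cases h : incidence s.1 t.1 = 0
    · simp [h]
    · exfalso
      apply hij
      have h1 := (incidence_ne_zero h).2
      have h2 := s.2.2
      have h3 := t.2.2
      simp only [ComplexShape.up_Rel]
      omega
  d_comp_d' i j k hij _ := by
    refine AddCommGrpCat.hom_ext (AddMonoidHom.ext fun c => funext fun s => ?_)
    change ∑ t : Face K j, incidence s.1 t.1 • ∑ r : Face K i, incidence t.1 r.1 • c r = 0
    simp only [Finset.smul_sum, smul_smul]
    rw [Finset.sum_comm]
    refine Finset.sum_eq_zero fun r _ => ?_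
    rw [← Finset.sum_smul]
    have hk : ((r.1).card : ℤ) = j := by
      have h3 := r.2.2
      simp only [ComplexShape.up_Rel] at hij
      omega
    rw [sum_incidence K j s.2.1 (K.isRelLowerSet_faces r.2.1).1 hk, zero_smul]

variable {K L}

/-- A simplex of a subcomplex, seen in the ambient complex. -/
def faceIncl (h : L ≤ K) {n : ℤ} (s : Face L n) : Face K n := ⟨s.1, h s.2.1, s.2.2⟩

open Classical in
/-- Extension by zero of chains of a subcomplex. -/
def chainExt (_h : L ≤ K) (n : ℤ) : (Face L n → G) →+ (Face K n → G) where
  toFun c := fun s => if hs : s.1 ∈ L.faces then c ⟨s.1, hs, s.2.2⟩ else 0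
  map_zero' := by ext; simp
  map_add' a b := by
    ext s
    by_cases hs : s.1 ∈ L.faces <;> simp [hs]

theorem sum_face_eq {h : L ≤ K} {n : ℤ} (f : Face K n → G)
    (hf : ∀ s : Face K n, s.1 ∉ L.faces → f s = 0) :
    ∑ s : Face K n, f s = ∑ s : Face L n, f (faceIncl h s) := by
  classical
  symm
  apply Finset.sum_of_injOn (faceIncl h)
  · intro a _ b _ hab
    exact Subtype.ext (congrArg (fun z : Face K n => z.1) hab)
  · simp
  · intro s _ hs
    apply hf
    intro hsL
    exact hs ⟨⟨s.1, hsL, s.2.2⟩, by simp, rfl⟩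
  · simp

/-- The inclusion `C_*(L; G) → C_*(K; G)` of a subcomplex `L` of `K`. -/
def chainsIncl (h : L ≤ K) : chains L G ⟶ chains K G where
  f n := AddCommGrpCat.ofHom (chainExt G h n)
  comm' i j _ := by
    refine AddCommGrpCat.hom_ext (AddMonoidHom.ext fun c => funext fun t => ?_)
    change ∑ s : Face K i, incidence s.1 t.1 • chainExt G h i c s
      = chainExt G h j (boundary L G i j c) t
    rw [sum_face_eq (G := G) (h := h)]
    · by_cases ht : t.1 ∈ L.faces
      · simp only [chainExt, AddMonoidHom.coe_mk, ZeroHom.coe_mk, ht, dite_true, boundary]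
        refine Finset.sum_congr rfl fun s _ => ?_
        rw [dif_pos (show (faceIncl h s).1 ∈ L.faces from s.2.1)]
        rfl
      · simp only [chainExt, AddMonoidHom.coe_mk, ZeroHom.coe_mk, ht, dite_false]
        refine Finset.sum_eq_zero fun s _ => ?_
        by_cases hi : incidence s.1 t.1 = 0
        · simp [hi, faceIncl]
        · exact absurd (mem_of_incidence_ne_zero s.2.1 (K.isRelLowerSet_faces t.2.1).1 hi) ht
    · intro s hs
      simp [chainExt, hs]

/-- The restriction `C^*(K; G) → C^*(L; G)` to a subcomplex `L` of `K`. -/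
def cochainsRes (h : L ≤ K) : cochains K G ⟶ cochains L G where
  f n := AddCommGrpCat.ofHom
    { toFun := fun c s => c (faceIncl h s)
      map_zero' := rfl
      map_add' := fun _ _ => rfl }
  comm' i j _ := by
    refine AddCommGrpCat.hom_ext (AddMonoidHom.ext fun c => funext fun s => ?_)
    change ∑ t : Face L i, incidence s.1 t.1 • c (faceIncl h t)
      = ∑ t : Face K i, incidence s.1 t.1 • c t
    rw [sum_face_eq (G := G) (h := h)]
    · rfl
    · intro t ht
      by_cases hi : incidence s.1 t.1 = 0
      · simp [hi]
      · exact absurd (mem_of_incidence_ne_zero s.2.1 (K.isRelLowerSet_faces t.2.1).1 hi) ht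

/-- The relative homology `H_n(K, L; G)`: homology of the quotient complex
`C_*(K; G) / C_*(L; G)`. -/
def relHomology (h : L ≤ K) (n : ℤ) : AddCommGrpCat.{max u v} :=
  (cokernel (chainsIncl G h)).homology n

/-- The relative cohomology `H^n(K, L; G)`: cohomology of the complex
`ker (C^*(K; G) → C^*(L; G))`. -/
def relCohomology (h : L ≤ K) (n : ℤ) : AddCommGrpCat.{max u v} :=
  (kernel (cochainsRes G h)).homology n

end Chains

/-! ### Morse tiles and Morse tilings -/

/-- A Morse tile: a simplex deprived of some of its facets (recorded by the set `removed` of the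
vertices opposite to them) and, if at least one facet is removed, of a possibly empty face of
codimension at least two, the Morse face. A Morse face lying inside the removed facets would
remove nothing more, so a nonempty Morse face is required not to lie in any of them, that is, to
contain every vertex in `removed`. -/
structure MorseTile (V : Type u) where
  simplex : Finset V
  simplex_nonempty : simplex.Nonempty
  removed : Finset V
  removed_subset : removed ⊆ simplex
  morseFace : Finset V
  morseFace_subset : morseFace ⊆ simplex
  morseFace_eq_empty : removed = ∅ → morseFace = ∅
  morseFace_codim : morseFace.Nonempty → morseFace.card + 2 ≤ simplex.card
  removed_subset_morseFace : morseFace.Nonempty → removed ⊆ morseFace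

namespace MorseTile

variable {V : Type u} (T : MorseTile V)

/-- The number of removed facets. -/
def order : ℕ := T.removed.card

/-- The dimension of the underlying simplex. -/
def dim : ℕ := T.simplex.card - 1

/-- Critical tiles: those of order `k` with Morse face of dimension `k - 1` (the closed simplices
if `k = 0`), and the open simplices. -/
def IsCritical : Prop := T.morseFace.card = T.order ∨ T.order = T.simplex.card

/-- The underlying closed simplex of the tile, with all its faces. -/
def closure : PreAbstractSimplicialComplex V where
  faces := {s | s.Nonempty ∧ s ⊆ T.simplex}
  isRelLowerSet_faces := by
    intro s hs
    exact ⟨hs.1, fun t hts ht => ⟨ht, Finset.Subset.trans hts hs.2⟩⟩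

/-- The subcomplex of `T.closure` that was removed: the faces which lie in a removed facet or in
the Morse face. -/
def complement : PreAbstractSimplicialComplex V where
  faces := {s | s.Nonempty ∧ s ⊆ T.simplex ∧ ((∃ w ∈ T.removed, w ∉ s) ∨ s ⊆ T.morseFace)}
  isRelLowerSet_faces := by
    intro s hs
    refine ⟨hs.1, fun t hts ht => ⟨ht, Finset.Subset.trans hts hs.2.1, ?_⟩⟩
    rcases hs.2.2 with ⟨w, hw, hws⟩ | h
    · exact Or.inl ⟨w, hw, fun h => hws (hts h)⟩
    · exact Or.inr (Finset.Subset.trans hts h)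

theorem complement_le : T.complement ≤ T.closure := fun _ hs => ⟨hs.1, hs.2.1⟩

/-- The tile as a set of points. -/
def carrier [Fintype V] [DecidableEq V] : Set (V → ℝ) :=
  closedSimplex T.simplex \
    ((⋃ w ∈ T.removed, closedSimplex (T.simplex.erase w)) ∪ closedSimplex T.morseFace)

end MorseTile

section Tilings

variable {V : Type u} [Fintype V] [LinearOrder V]

/-- A Morse tiling of the simplicial complex `K`: a partition of its realization by Morse tiles
such that for every `j` the union of the tiles of dimension greater than `j` is closed. -/
structure MorseTiling (K : PreAbstractSimplicialComplex V) where
  tiles : Set (MorseTile V)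
  simplex_mem : ∀ T ∈ tiles, T.simplex ∈ K.faces
  disjoint : ∀ T ∈ tiles, ∀ T' ∈ tiles, T ≠ T' → Disjoint T.carrier T'.carrier
  cover : ⋃ T ∈ tiles, T.carrier = realization K
  closed : ∀ j : ℕ, IsClosedIn (realization K) (⋃ T ∈ {T ∈ tiles | j < T.dim}, T.carrier)

variable {K : PreAbstractSimplicialComplex V}

namespace MorseTiling

/-- There is an arrow `T → T'` in the quiver of the tiling iff the closure of `T` meets `T'`.
The trivial loops `T → T` are left out. -/
def Arrow (τ : MorseTiling K) (T T' : MorseTile V) : Prop :=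
  T ∈ τ.tiles ∧ T' ∈ τ.tiles ∧ T ≠ T' ∧ (closedSimplex T.simplex ∩ T'.carrier).Nonempty

/-- The label of an arrow `T → T'`: the dimension of the common face of the closures. -/
def label (T T' : MorseTile V) : ℤ := ((T.simplex ∩ T'.simplex).card : ℤ) - 1

/-- The quiver has no oriented cycle (closed path of positive length) all of whose arrows have
labels at most `q`. -/
def ShellableUpTo (τ : MorseTiling K) (q : ℕ) : Prop :=
  ∀ T, ¬ Relation.TransGen (fun A B => τ.Arrow A B ∧ label A B ≤ (q : ℤ)) T T

/-- A partial shelling up to order `q`: distinct tiles `T₁, …, T_N` of order at most `q + 1`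
(here indexed from zero) such that, with `S_p = T₁ ∪ ⋯ ∪ T_p`, every `S_p ∩ K^(q)` is closed in
the `q`-skeleton `K^(q)`, and `S_N ∩ K^(q) = K^(q)`. -/
structure PartialShelling (τ : MorseTiling K) (q : ℕ) where
  length : ℕ
  tile : Fin length → MorseTile V
  tile_mem : ∀ i, tile i ∈ τ.tiles
  tile_injective : Function.Injective tile
  order_le : ∀ i, (tile i).order ≤ q + 1
  closed : ∀ p : ℕ, p ≤ length → IsClosedIn (realization (skeleton K q))
    ((⋃ i ∈ {i : Fin length | (i : ℕ) < p}, (tile i).carrier) ∩ realization (skeleton K q))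
  cover : (⋃ i, (tile i).carrier) ∩ realization (skeleton K q) = realization (skeleton K q)

namespace PartialShelling

variable {τ : MorseTiling K} {q : ℕ} (P : τ.PartialShelling q)

/-- The union `S_p` of the first `p` tiles. -/
def union (p : ℤ) : Set (V → ℝ) :=
  ⋃ i ∈ {i : Fin P.length | ((i : ℕ) : ℤ) < p}, (P.tile i).carrier

/-- The subcomplex `K_p` of the `q`-skeleton with realization `S_p ∩ K^(q)`. It is empty for
`p ≤ 0` and the whole `q`-skeleton for `p ≥ N`. -/
def stage (p : ℤ) : PreAbstractSimplicialComplex V := subcomplexIn (skeleton K q) (P.union p)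

theorem stage_le (p : ℤ) : P.stage p ≤ skeleton K q := subcomplexIn_le _ _

variable (G : Type v) [AddCommGroup G]

/-- The increasing filtration of `C_*(K^(q); G)` by the `C_*(K_p; G)`. -/
def chainFil (p n : ℤ) : AddSubgroup ((chains (skeleton K q) G).X n) :=
  ((chainsIncl G (P.stage_le p)).f n).hom.range

/-- The decreasing filtration of `C^*(K^(q); G)` by the
`C^*(K^(q), K_p; G) = ker (C^*(K^(q); G) → C^*(K_p; G))`. -/
def cochainFil (p n : ℤ) : AddSubgroup ((cochains (skeleton K q) G).X n) :=
  ((cochainsRes G (P.stage_le p)).f n).hom.ker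

/-- The increasing filtration of `H_*(K^(q); G)` by the images of the `H_*(K_p; G)`. -/
def homologyFil (p n : ℤ) : AddSubgroup ((chains (skeleton K q) G).homology n) :=
  (HomologicalComplex.homologyMap (chainsIncl G (P.stage_le p)) n).hom.range

/-- The decreasing filtration of `H^*(K^(q); G)` by the images of the `H^*(K^(q), K_p; G)`. -/
def cohomologyFil (p n : ℤ) : AddSubgroup ((cochains (skeleton K q) G).homology n) :=
  (HomologicalComplex.homologyMap (kernel.ι (cochainsRes G (P.stage_le p))) n).hom.range

end PartialShelling

end MorseTiling

end Tilings

/-! ### The spectral sequence of a filtered complex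

The homological and the cohomological conventions are treated together: `ε = -1` for a
differential of degree `-1` and an increasing filtration `F p`, and `ε = 1` for a differential of
degree `1` and a decreasing filtration `F p`. In both cases `F (p + ε)` is contained in `F p`, and
`d^r` maps position `(p, s)` to position `(p + ε r, s + ε (1 - r))`. -/

section SpectralSequences

variable {c : ComplexShape ℤ} (C : HomologicalComplex AddCommGrpCat.{v} c)
  (F : ℤ → (n : ℤ) → AddSubgroup (C.X n)) (ε : ℤ)

/-- `Z^r_p = {x ∈ F_p | d x ∈ F_{p + ε r}}` in degree `n`. -/
def ssCycles (r p n : ℤ) : AddSubgroup (C.X n) :=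
  F p n ⊓ (F (p + ε * r) (n + ε)).comap (C.d n (n + ε)).hom

/-- `Z^{r-1}_{p + ε} + d Z^{r-1}_{p - ε (r - 1)}` in degree `n`; the `r`-th page of the spectral
sequence of the filtered complex is the quotient of `Z^r_p` by it. -/
def ssBoundaries (r p n : ℤ) : AddSubgroup (C.X n) :=
  ssCycles C F ε (r - 1) (p + ε) n ⊔
    (ssCycles C F ε (r - 1) (p - ε * (r - 1)) (n - ε)).map (C.d (n - ε) n).hom

variable {c' : ℤ → ComplexShape (ℤ × ℤ)} (E : SpectralSequence AddCommGrpCat.{v} c' 0)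

/-- Identification of `E` with the spectral sequence of the filtered complex `(C, F)`: the group
at position `(p, s)` of the `r`-th page is `Z^r_p / (Z^{r-1}_{p+ε} + d Z^{r-1}_{p-ε(r-1)})` in
total degree `p + s`, the differentials of the pages are induced by the differential of `C`, and
the isomorphism from the homology of a page to the next page is the identity on
representatives. -/
structure IsInducedBy where
  /-- the class in the `r`-th page -/
  cls (r : ℤ) (hr : 0 ≤ r) (p s : ℤ) :
    ssCycles C F ε r p (p + s) →+ (E.page r hr).X (p, s)
  cls_surjective (r : ℤ) (hr : 0 ≤ r) (p s : ℤ) : Function.Surjective (cls r hr p s)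
  cls_eq_zero_iff (r : ℤ) (hr : 0 ≤ r) (p s : ℤ) (x : ssCycles C F ε r p (p + s)) :
    cls r hr p s x = 0 ↔ x.1 ∈ ssBoundaries C F ε r p (p + s)
  d_cls (r : ℤ) (hr : 0 ≤ r) (p s : ℤ) (x : ssCycles C F ε r p (p + s))
    (y : ssCycles C F ε r (p + ε * r) ((p + ε * r) + (s + ε * (1 - r))))
    (hxy : y.1 = (C.d (p + s) ((p + ε * r) + (s + ε * (1 - r)))).hom x.1) :
    ((E.page r hr).d (p, s) (p + ε * r, s + ε * (1 - r))).hom (cls r hr p s x) =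
      cls r hr (p + ε * r) (s + ε * (1 - r)) y
  iso_cls (r : ℤ) (hr : 0 ≤ r) (p s : ℤ) (x : ssCycles C F ε r p (p + s))
    (x' : ssCycles C F ε (r + 1) p (p + s)) (hx : x.1 = x'.1)
    (z : (E.page r hr).cycles (p, s))
    (hz : ((E.page r hr).iCycles (p, s)).hom z = cls r hr p s x) :
    (E.iso r (r + 1) (p, s) rfl hr).hom.hom (((E.page r hr).homologyπ (p, s)).hom z) =
      cls (r + 1) (by lia) p s x'

/-- `E` degenerates at the page `N` and converges to `H` with its filtration `Φ` (where
`Φ (p + ε) ⊆ Φ p`): the filtration is finite, the differentials of the pages `r ≥ N` vanish, and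
these pages are the graded pieces `Φ_p / Φ_{p + ε}` of `H`, in total degree `p + s` at position
`(p, s)`. -/
structure ConvergesTo (N : ℕ) (H : ℤ → AddCommGrpCat.{v})
    (Φ : ℤ → (n : ℤ) → AddSubgroup (H n)) : Prop where
  le (p n : ℤ) : Φ (p + ε) n ≤ Φ p n
  exhaustive (n : ℤ) : ∃ p, Φ p n = ⊤
  separated (n : ℤ) : ∃ p, Φ p n = ⊥
  degenerates (r : ℤ) (hr : 0 ≤ r) (hN : (N : ℤ) ≤ r) (a b : ℤ × ℤ) : (E.page r hr).d a b = 0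
  limit (r : ℤ) (hr : 0 ≤ r) (hN : (N : ℤ) ≤ r) (p s : ℤ) :
    Nonempty ((E.page r hr).X (p, s) ≃+
      (Φ p (p + s) ⧸ (Φ (p + ε) (p + s)).addSubgroupOf (Φ p (p + s))))

end SpectralSequences

end

end MorseTiled

namespace MorseTiled

noncomputable section

/-! ### Homology of complexes of abelian groups, in terms of elements. -/

section HomologyClass

/-! Each tile is a union of open simplices, those of its "cells": the faces `s` of the underlying
simplex that contain all vertices opposite to removed facets and do not lie in the Morse face. Since
every `S_p ∩ K^(q)` is closed, a simplex of the `q`-skeleton belongs to `K_p` as soon as its open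
simplex lies in one of the first `p` tiles (`mem_stage_iff`). Tiles are disjoint, so the simplices
gained when passing from one stage to the next are exactly the cells of dimension at most `q` of the
added tile (`mem_cells_iff`).

The graded pieces of the filtration therefore agree, in degrees at most `q`, with the relative
(co)chains of the tile modulo what was removed from it. The first page in degree `n` is the homology
of such a piece and involves degrees `n - 1`, `n`, `n + 1`, which explains the bound `n < q`. Both
this page (`nonempty_first_page_cells`) and the relative groups (`nonempty_relHomology_addEquiv`,
`nonempty_relCohomology_addEquiv`) are compared with one model, `CellHomology`.

If a tile is not critical, some vertex can be added to or deleted from any cell without leaving the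
set of cells (`exists_toggle_mem_cells`). This pairs the cells off as in the contraction of a cone,
and the homology vanishes (`exists_cellMap_eq`). A tile outside the partial shelling has no cell of
dimension at most `q`, because the shelling already covers the skeleton; its relative groups vanish
below `q`.

Convergence is a general fact: a filtration with at most `N` jumps leaves no room for a nonzero
differential from page `N` on (`IsInducedBy.convergesTo`). Homology and cohomology share the algebra
through the sign `ε` and an arbitrary incidence matrix `κ`. -/

theorem exists_addEquiv_of_surjective {A B B' : Type*} [AddCommGroup A] [AddCommGroup B]
    [AddCommGroup B'] (f : A →+ B) (g : A →+ B') (hf : Function.Surjective f)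
    (hg : Function.Surjective g) (h : ∀ x, f x = 0 ↔ g x = 0) :
    ∃ e : B ≃+ B', ∀ x, e (f x) = g x := by
  refine ⟨(QuotientAddGroup.quotientKerEquivOfSurjective f hf).symm.trans
    ((QuotientAddGroup.quotientAddEquivOfEq (show f.ker = g.ker by ext x; exact h x)).trans
      (QuotientAddGroup.quotientKerEquivOfSurjective g hg)), fun x => ?_⟩
  have : (QuotientAddGroup.quotientKerEquivOfSurjective f hf).symm (f x) = (x : _ ⧸ f.ker) :=
    (AddEquiv.symm_apply_eq _).2 rfl
  rw [AddEquiv.trans_apply, this]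
  rfl

theorem nonempty_addEquiv_of_surjective {A B B' : Type*} [AddCommGroup A] [AddCommGroup B]
    [AddCommGroup B'] (f : A →+ B) (g : A →+ B') (hf : Function.Surjective f)
    (hg : Function.Surjective g) (h : ∀ x, f x = 0 ↔ g x = 0) : Nonempty (B ≃+ B') :=
  let ⟨e, _⟩ := exists_addEquiv_of_surjective f g hf hg h
  ⟨e⟩

variable {ι : Type*} {c : ComplexShape ι} (C : HomologicalComplex AddCommGrpCat.{v} c)

theorem d_d_apply (i j k : ι) (x : C.X i) : (C.d j k).hom ((C.d i j).hom x) = 0 :=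
  congrArg (fun f : C.X i ⟶ C.X k => f.hom x) (C.d_comp_d i j k)

theorem iCycles_injective (n : ι) : Function.Injective (C.iCycles n).hom :=
  (AddCommGrpCat.mono_iff_injective _).1 inferInstance

theorem homologyπ_surjective (n : ι) : Function.Surjective (C.homologyπ n).hom :=
  (AddCommGrpCat.epi_iff_surjective _).1 inferInstance

theorem d_iCycles_apply (n k : ι) (z : C.cycles n) : (C.d n k).hom ((C.iCycles n).hom z) = 0 :=
  congrArg (fun f : C.cycles n ⟶ C.X k => f.hom z) (C.iCycles_d n k)

theorem exists_iCycles_eq {n k : ι} (hk : c.next n = k) {x : C.X n} (hx : (C.d n k).hom x = 0) :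
    ∃ z, (C.iCycles n).hom z = x := by
  -- The concrete kernel of the differential maps to the abstract object of cycles by its universal
  -- property.
  let f : AddCommGrpCat.of (C.d n k).hom.ker ⟶ C.X n :=
    AddCommGrpCat.ofHom (C.d n k).hom.ker.subtype
  have hf : f ≫ C.d n k = 0 := by
    refine AddCommGrpCat.hom_ext (AddMonoidHom.ext fun y => y.2)
  exact ⟨(C.liftCycles f k hk hf).hom ⟨x, hx⟩,
    congrArg (fun g : AddCommGrpCat.of (C.d n k).hom.ker ⟶ C.X n => g.hom ⟨x, hx⟩)
      (C.liftCycles_i f k hk hf)⟩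

theorem homologyπ_eq_zero_iff {i n : ι} (hi : c.prev n = i) (z : C.cycles n) :
    (C.homologyπ n).hom z = 0 ↔ ∃ w, (C.d i n).hom w = (C.iCycles n).hom z := by
  have hex : (ShortComplex.mk (C.toCycles i n) (C.homologyπ n)
      (C.toCycles_comp_homologyπ i n)).Exact :=
    ShortComplex.exact_of_g_is_cokernel _ (C.homologyIsCokernel i n hi)
  have htoi (w : C.X i) : (C.iCycles n).hom ((C.toCycles i n).hom w) = (C.d i n).hom w :=
    congrArg (fun g : C.X i ⟶ C.X n => g.hom w) (C.toCycles_i i n)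
  constructor
  · intro h
    obtain ⟨w, hw⟩ := (ShortComplex.ab_exact_iff _).1 hex z h
    refine ⟨w, ?_⟩
    rw [← htoi]
    exact congrArg _ hw
  · rintro ⟨w, hw⟩
    have : (C.toCycles i n).hom w = z := iCycles_injective C n (by rw [htoi, hw])
    rw [← this]
    exact congrArg (fun g : C.X i ⟶ C.homology n => g.hom w) (C.toCycles_comp_homologyπ i n)

/-- Homology as a concrete quotient: cycles modulo boundaries. -/
theorem exists_homology_addEquiv {i n k : ι} (hi : c.prev n = i) (hk : c.next n = k)
    {M₀ M₁ M₂ : Type*} [AddCommGroup M₀] [AddCommGroup M₁] [AddCommGroup M₂]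
    (α : M₀ →+ M₁) (β : M₁ →+ M₂) (e₀ : C.X i ≃+ M₀) (e₁ : C.X n ≃+ M₁) (e₂ : C.X k ≃+ M₂)
    (h₀ : ∀ x, e₁ ((C.d i n).hom x) = α (e₀ x)) (h₁ : ∀ x, e₂ ((C.d n k).hom x) = β (e₁ x)) :
    Nonempty (C.homology n ≃+ β.ker ⧸ α.range.addSubgroupOf β.ker) := by
  let f : C.cycles n →+ β.ker :=
    (e₁.toAddMonoidHom.comp (C.iCycles n).hom).codRestrict β.ker fun z => by
      change β (e₁ _) = 0
      rw [← h₁, d_iCycles_apply, map_zero]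
  let g : C.cycles n →+ β.ker ⧸ α.range.addSubgroupOf β.ker := (QuotientAddGroup.mk' _).comp f
  have hg : Function.Surjective g := by
    refine (QuotientAddGroup.mk'_surjective _).comp ?_
    rintro ⟨y, hy⟩
    obtain ⟨z, hz⟩ := exists_iCycles_eq C hk (x := e₁.symm y) (by
      apply e₂.injective
      rw [h₁, e₁.apply_symm_apply, map_zero]
      exact hy)
    refine ⟨z, Subtype.ext ?_⟩
    change e₁ ((C.iCycles n).hom z) = y
    rw [hz, e₁.apply_symm_apply]
  have hker : g.ker = (C.homologyπ n).hom.ker := by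
    ext z
    rw [AddMonoidHom.mem_ker, AddMonoidHom.mem_ker, homologyπ_eq_zero_iff C hi]
    change ((f z : β.ker) : β.ker ⧸ α.range.addSubgroupOf β.ker) = 0 ↔ _
    rw [QuotientAddGroup.eq_zero_iff, AddSubgroup.mem_addSubgroupOf]
    change (∃ w, α w = e₁ _) ↔ _
    constructor
    · rintro ⟨w, hw⟩
      refine ⟨e₀.symm w, e₁.injective ?_⟩
      rw [h₀, e₀.apply_symm_apply, hw]
    · rintro ⟨w, hw⟩
      exact ⟨e₀ w, by rw [← h₀, hw]⟩
  exact ⟨(QuotientAddGroup.quotientKerEquivOfSurjective _ (homologyπ_surjective C n)).symm.trans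
    ((QuotientAddGroup.quotientAddEquivOfEq hker.symm).trans
      (QuotientAddGroup.quotientKerEquivOfSurjective g hg))⟩

/-- The image in homology of a degreewise injective morphism consists of the classes of the cycles
in its range. -/
theorem range_homologyMap {A : HomologicalComplex AddCommGrpCat.{v} c} (φ : A ⟶ C) (n : ι)
    (hφ : ∀ m, Function.Injective (φ.f m).hom) :
    (HomologicalComplex.homologyMap φ n).hom.range =
      ((φ.f n).hom.range.comap (C.iCycles n).hom).map (C.homologyπ n).hom := by
  have hnat (z : A.cycles n) : (HomologicalComplex.homologyMap φ n).hom ((A.homologyπ n).hom z) =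
      (C.homologyπ n).hom ((HomologicalComplex.cyclesMap φ n).hom z) :=
    congrArg (fun g : A.cycles n ⟶ C.homology n => g.hom z)
      (HomologicalComplex.homologyπ_naturality φ n)
  have hi (z : A.cycles n) : (C.iCycles n).hom ((HomologicalComplex.cyclesMap φ n).hom z) =
      (φ.f n).hom ((A.iCycles n).hom z) :=
    congrArg (fun g : A.cycles n ⟶ C.X n => g.hom z) (HomologicalComplex.cyclesMap_i φ n)
  ext y
  constructor
  · rintro ⟨x, rfl⟩
    obtain ⟨z, rfl⟩ := homologyπ_surjective A n x
    rw [hnat]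
    exact ⟨_, ⟨_, (hi z).symm⟩, rfl⟩
  · rintro ⟨z, ⟨a, ha⟩, rfl⟩
    -- Injectivity in the next degree forces a chain whose image is a cycle to be a cycle itself.
    have hda : (A.d n (c.next n)).hom a = 0 := by
      apply hφ
      have : (φ.f _).hom ((A.d n (c.next n)).hom a) = (C.d n (c.next n)).hom ((φ.f n).hom a) :=
        (congrArg (fun g : A.X n ⟶ C.X (c.next n) => g.hom a) (φ.comm n (c.next n))).symm
      rw [this, ha, d_iCycles_apply, map_zero]
    obtain ⟨z', hz'⟩ := exists_iCycles_eq A rfl hda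
    refine ⟨(A.homologyπ n).hom z', ?_⟩
    rw [hnat]
    congr 1
    apply iCycles_injective C n
    rw [hi, hz', ha]

end HomologyClass

/-! ### Construction of the spectral sequence of a filtered complex. -/

section Pages

variable {c : ComplexShape ℤ} (C : HomologicalComplex AddCommGrpCat.{v} c)
  (F : ℤ → (n : ℤ) → AddSubgroup (C.X n)) (ε : ℤ)

variable {C F ε}

theorem mem_ssCycles {r p n m p' : ℤ} (hm : n + ε = m) (hp : p + ε * r = p') {x : C.X n} :
    x ∈ ssCycles C F ε r p n ↔ x ∈ F p n ∧ (C.d n m).hom x ∈ F p' m := by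
  subst hm hp
  exact Iff.rfl

theorem mem_ssBoundaries {r p n m p' : ℤ} (hm : m + ε = n) (hp : p' = p - ε * (r - 1))
    {x : C.X n} :
    x ∈ ssBoundaries C F ε r p n ↔ ∃ y ∈ ssCycles C F ε (r - 1) (p + ε) n,
      ∃ w ∈ ssCycles C F ε (r - 1) p' m, y + (C.d m n).hom w = x := by
  obtain rfl : m = n - ε := by lia
  subst hp
  rw [ssBoundaries, AddSubgroup.mem_sup]
  simp only [AddSubgroup.mem_map, exists_exists_and_eq_and]

variable (C F ε)

/-- The group at filtration degree `p` and total degree `n` of the `r`-th page. -/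
def ssPageX (r p n : ℤ) : AddCommGrpCat.{v} :=
  AddCommGrpCat.of (ssCycles C F ε r p n ⧸
    (ssBoundaries C F ε r p n).addSubgroupOf (ssCycles C F ε r p n))

/-- The class of an element of `Z^r_p`. -/
def ssMk (r p n : ℤ) : ssCycles C F ε r p n →+ ssPageX C F ε r p n := QuotientAddGroup.mk' _

variable {C F ε}

theorem ssMk_surjective (r p n : ℤ) : Function.Surjective (ssMk C F ε r p n) :=
  QuotientAddGroup.mk'_surjective _

theorem ssMk_eq_zero_iff (r p n : ℤ) (x : ssCycles C F ε r p n) :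
    ssMk C F ε r p n x = 0 ↔ x.1 ∈ ssBoundaries C F ε r p n := by
  change (x : _ ⧸ (ssBoundaries C F ε r p n).addSubgroupOf (ssCycles C F ε r p n)) = 0 ↔ _
  rw [QuotientAddGroup.eq_zero_iff, AddSubgroup.mem_addSubgroupOf]

theorem ssMk_eq_iff (r p n : ℤ) (x y : ssCycles C F ε r p n) :
    ssMk C F ε r p n x = ssMk C F ε r p n y ↔ x.1 - y.1 ∈ ssBoundaries C F ε r p n := by
  rw [← sub_eq_zero, ← map_sub, ssMk_eq_zero_iff]
  rfl

theorem d_mem_ssCycles {r p n p' n' : ℤ} (hp : p + ε * r = p') (hn : n + ε = n') {x : C.X n}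
    (hx : x ∈ ssCycles C F ε r p n) : (C.d n n').hom x ∈ ssCycles C F ε r p' n' := by
  rw [mem_ssCycles hn hp] at hx
  refine (mem_ssCycles rfl rfl).2 ⟨hx.2, ?_⟩
  rw [d_d_apply]
  exact zero_mem _

variable (C F ε) in
/-- The differential of a page, as a map out of `Z^r_p`. -/
def ssDiffCycles (r p n p' n' : ℤ) (hp : p + ε * r = p') (hn : n + ε = n') :
    ssCycles C F ε r p n →+ ssCycles C F ε r p' n' :=
  ((C.d n n').hom.comp (ssCycles C F ε r p n).subtype).codRestrict _
    fun x => d_mem_ssCycles hp hn x.2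

/-- Of `x = y + d w` only `d y` survives, and `y` lies in `Z^{r-1}_{p+ε}`. That is precisely the
group whose image under `d` enters the boundaries at `p' = p + ε r`, because `p' - ε (r - 1) = p +
ε`. -/
theorem d_mem_ssBoundaries {r p n p' n' : ℤ} (hp : p + ε * r = p') (hn : n + ε = n') {x : C.X n}
    (hx : x ∈ ssBoundaries C F ε r p n) : (C.d n n').hom x ∈ ssBoundaries C F ε r p' n' := by
  obtain ⟨y, hy, w, -, rfl⟩ := (mem_ssBoundaries (m := n - ε) (by ring) rfl).1 hx
  refine (mem_ssBoundaries hn (p' := p + ε) (by rw [← hp]; ring)).2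
    ⟨0, zero_mem _, y, hy, ?_⟩
  rw [map_add, d_d_apply, add_zero, zero_add]

variable (C F ε) in
/-- The differential of a page. -/
def ssDiff (r p n p' n' : ℤ) (hp : p + ε * r = p') (hn : n + ε = n') :
    ssPageX C F ε r p n ⟶ ssPageX C F ε r p' n' :=
  AddCommGrpCat.ofHom (QuotientAddGroup.map _ _ (ssDiffCycles C F ε r p n p' n' hp hn) (by
    intro x hx
    exact d_mem_ssBoundaries hp hn hx))

theorem ssDiff_comp (r p n p' n' p'' n'' : ℤ) (hp : p + ε * r = p') (hn : n + ε = n')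
    (hp' : p' + ε * r = p'') (hn' : n' + ε = n'') :
    ssDiff C F ε r p n p' n' hp hn ≫ ssDiff C F ε r p' n' p'' n'' hp' hn' = 0 := by
  refine AddCommGrpCat.hom_ext (AddMonoidHom.ext fun x => ?_)
  obtain ⟨x, rfl⟩ := ssMk_surjective r p n x
  refine (ssMk_eq_zero_iff r p'' n'' _).2 ?_
  change (C.d n' n'').hom ((C.d n n').hom x.1) ∈ _
  rw [d_d_apply]
  exact zero_mem _

variable (C F ε) in
open Classical in
/-- The `r`-th page of the spectral sequence of a filtered complex. -/
def ssPage (r : ℤ) :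
    HomologicalComplex AddCommGrpCat.{v} (ComplexShape.up' ((ε * r, ε * (1 - r)) : ℤ × ℤ)) where
  X a := ssPageX C F ε r a.1 (a.1 + a.2)
  d a b := if h : a + (ε * r, ε * (1 - r)) = b then
      ssDiff C F ε r a.1 (a.1 + a.2) b.1 (b.1 + b.2) (by rw [← h]; rfl)
        (by subst h; simp only [Prod.fst_add, Prod.snd_add]; ring)
    else 0
  shape a b hab := dif_neg hab
  d_comp_d' a b e hab hbe := by
    replace hab : a + (ε * r, ε * (1 - r)) = b := hab
    replace hbe : b + (ε * r, ε * (1 - r)) = e := hbe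
    rw [dif_pos hab, dif_pos hbe]
    exact ssDiff_comp ..

theorem ssPage_d {r : ℤ} {a b : ℤ × ℤ} (h : a + (ε * r, ε * (1 - r)) = b) (hp : a.1 + ε * r = b.1)
    (hn : a.1 + a.2 + ε = b.1 + b.2) :
    (ssPage C F ε r).d a b = ssDiff C F ε r a.1 (a.1 + a.2) b.1 (b.1 + b.2) hp hn :=
  dif_pos h

theorem ssPage_d_ssMk_eq_zero_iff {r : ℤ} {a b : ℤ × ℤ} (h : a + (ε * r, ε * (1 - r)) = b)
    (x : ssCycles C F ε r a.1 (a.1 + a.2)) :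
    ((ssPage C F ε r).d a b).hom (ssMk C F ε r _ _ x) = 0 ↔
      (C.d (a.1 + a.2) (b.1 + b.2)).hom x.1 ∈ ssBoundaries C F ε r b.1 (b.1 + b.2) := by
  have hp : a.1 + ε * r = b.1 := by rw [← h]; rfl
  have hn : a.1 + a.2 + ε = b.1 + b.2 := by
    subst h; simp only [Prod.fst_add, Prod.snd_add]; ring
  rw [ssPage_d h hp hn]
  exact ssMk_eq_zero_iff _ _ _ _

theorem ssCycles_succ_le (hF : ∀ p n, F (p + ε) n ≤ F p n) (r p n : ℤ) :
    ssCycles C F ε (r + 1) p n ≤ ssCycles C F ε r p n := by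
  intro x hx
  refine ⟨hx.1, hF _ _ ?_⟩
  rw [show p + ε * r + ε = p + ε * (r + 1) by ring]
  exact hx.2

/-- The kernel of the page differential is represented by `Z^{r+1}_p`: if `d x = y + d w` with `y`
one step deeper in the filtration, then `x - w` has differential `y`, and `w` is itself a boundary
for the page `r`. -/
theorem exists_mem_ssCycles_succ (hF : ∀ p n, F (p + ε) n ≤ F p n) {r p n p' n' : ℤ}
    (hp : p + ε * r = p') (hn : n + ε = n') {x : C.X n} (hx : x ∈ ssCycles C F ε r p n)
    (hdx : (C.d n n').hom x ∈ ssBoundaries C F ε r p' n') :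
    ∃ x' ∈ ssCycles C F ε (r + 1) p n, x - x' ∈ ssBoundaries C F ε r p n := by
  obtain ⟨y, hy, w, hw, hyw⟩ :=
    (mem_ssBoundaries hn (p' := p + ε) (by rw [← hp]; ring)).1 hdx
  refine ⟨x - w, (mem_ssCycles hn (p' := p' + ε) (by rw [← hp]; ring)).2 ⟨?_, ?_⟩, ?_⟩
  · exact sub_mem hx.1 (hF _ _ hw.1)
  · rw [map_sub, ← hyw, add_sub_cancel_right]
    exact hy.1
  · rw [sub_sub_cancel]
    exact AddSubgroup.mem_sup_left hw

/-- The elements of `Z^{r+1}_p` that vanish on the next page are those whose class on the page `r`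
is hit by `d^r`. For the converse, write `d v - x = z + d u`; then `x = -z + d (v - u)`, and `-z`
has the same differential as `x`, which upgrades it from `Z^{r-1}` to `Z^r`. -/
theorem mem_ssBoundaries_succ_iff (hF : ∀ p n, F (p + ε) n ≤ F p n) {r p n p' n' : ℤ}
    (hp : p' + ε * r = p) (hn : n' + ε = n) {x : C.X n} (hx : x ∈ ssCycles C F ε (r + 1) p n) :
    x ∈ ssBoundaries C F ε (r + 1) p n ↔
      ∃ v ∈ ssCycles C F ε r p' n', (C.d n' n).hom v - x ∈ ssBoundaries C F ε r p n := by
  rw [mem_ssBoundaries hn (p' := p') (by rw [← hp]; ring), add_sub_cancel_right]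
  constructor
  · rintro ⟨y, hy, w, hw, rfl⟩
    refine ⟨w, hw, ?_⟩
    rw [sub_add_cancel_right, neg_mem_iff]
    refine AddSubgroup.mem_sup_left (ssCycles_succ_le hF _ _ _ ?_)
    rwa [sub_add_cancel]
  · rintro ⟨v, hv, hvx⟩
    obtain ⟨z, hz, u, hu, hzu⟩ := (mem_ssBoundaries hn (p' := p' + ε) (by rw [← hp]; ring)).1 hvx
    have hxe : -z + (C.d n' n).hom (v - u) = x := by
      rw [map_sub]
      have : (C.d n' n).hom v - x = z + (C.d n' n).hom u := hzu.symm
      rw [sub_eq_iff_eq_add] at this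
      rw [this]
      abel
    refine ⟨-z, ?_, v - u, ?_, hxe⟩
    · refine (mem_ssCycles rfl rfl).2 ⟨neg_mem hz.1, ?_⟩
      have hdz : (C.d n (n + ε)).hom (-z) = (C.d n (n + ε)).hom x := by
        rw [← hxe, map_add, d_d_apply, add_zero]
      rw [hdz, show p + ε + ε * r = p + ε * (r + 1) by ring]
      exact hx.2
    · refine sub_mem hv ((mem_ssCycles hn hp).2 ⟨hF _ _ hu.1, ?_⟩)
      have := ((mem_ssCycles hn rfl).1 hu).2
      rwa [show p' + ε + ε * (r - 1) = p by rw [← hp]; ring] at this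

/-- Combines the two preceding facts on kernels and images: the homology of page `r` is presented as
a quotient of `Z^{r+1}_p` by the relations defining page `r + 1`. The last clause records that the
presentation is the identity on representatives. -/
theorem exists_ssPage_homology_hom (hF : ∀ p n, F (p + ε) n ≤ F p n) (r : ℤ) (a : ℤ × ℤ) :
    ∃ g : ssCycles C F ε (r + 1) a.1 (a.1 + a.2) →+ (ssPage C F ε r).homology a,
      Function.Surjective g ∧
      (∀ x, g x = 0 ↔ x.1 ∈ ssBoundaries C F ε (r + 1) a.1 (a.1 + a.2)) ∧
      ∀ (x : ssCycles C F ε r a.1 (a.1 + a.2)) (x' : ssCycles C F ε (r + 1) a.1 (a.1 + a.2)),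
        x.1 = x'.1 → ∀ z : (ssPage C F ε r).cycles a,
          ((ssPage C F ε r).iCycles a).hom z = ssMk C F ε r a.1 (a.1 + a.2) x →
          ((ssPage C F ε r).homologyπ a).hom z = g x' := by
  let b : ℤ × ℤ := a + (ε * r, ε * (1 - r))
  let e : ℤ × ℤ := a - (ε * r, ε * (1 - r))
  have hb : a + (ε * r, ε * (1 - r)) = b := rfl
  have he : e + (ε * r, ε * (1 - r)) = a := sub_add_cancel _ _
  have hb1 : a.1 + ε * r = b.1 := rfl
  have hb2 : a.1 + a.2 + ε = b.1 + b.2 := by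
    change _ = a.1 + ε * r + (a.2 + ε * (1 - r)); ring
  have he1 : e.1 + ε * r = a.1 := sub_add_cancel _ _
  have he2 : e.1 + e.2 + ε = a.1 + a.2 := by
    change (a.1 - ε * r + (a.2 - ε * (1 - r))) + ε = _; ring
  have hnext : (ComplexShape.up' ((ε * r, ε * (1 - r)) : ℤ × ℤ)).next a = b :=
    ComplexShape.next_eq' _ hb
  have hprev : (ComplexShape.up' ((ε * r, ε * (1 - r)) : ℤ × ℤ)).prev a = e :=
    ComplexShape.prev_eq' _ he
  let k : AddCommGrpCat.of (ssCycles C F ε (r + 1) a.1 (a.1 + a.2)) ⟶ (ssPage C F ε r).X a :=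
    AddCommGrpCat.ofHom ((ssMk C F ε r a.1 (a.1 + a.2)).comp
      (AddSubgroup.inclusion (ssCycles_succ_le hF r a.1 (a.1 + a.2))))
  have hk : k ≫ (ssPage C F ε r).d a b = 0 := by
    refine AddCommGrpCat.hom_ext (AddMonoidHom.ext fun x => ?_)
    refine (ssPage_d_ssMk_eq_zero_iff hb _).2 ?_
    refine AddSubgroup.mem_sup_left ((mem_ssCycles rfl rfl).2 ⟨?_, ?_⟩)
    · have := ((mem_ssCycles hb2 rfl).1 x.2).2
      rwa [show a.1 + ε * (r + 1) = b.1 + ε by rw [← hb1]; ring] at this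
    · change (C.d _ _).hom ((C.d _ _).hom x.1) ∈ _
      rw [d_d_apply]
      exact zero_mem _
  let l : AddCommGrpCat.of (ssCycles C F ε (r + 1) a.1 (a.1 + a.2)) ⟶ (ssPage C F ε r).cycles a :=
    (ssPage C F ε r).liftCycles k b hnext hk
  have hl (x : ssCycles C F ε (r + 1) a.1 (a.1 + a.2)) :
      ((ssPage C F ε r).iCycles a).hom (l.hom x) = k.hom x :=
    congrArg (fun f : AddCommGrpCat.of _ ⟶ (ssPage C F ε r).X a => f.hom x)
      ((ssPage C F ε r).liftCycles_i k b hnext hk)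
  refine ⟨((ssPage C F ε r).homologyπ a).hom.comp l.hom, ?_, ?_, ?_⟩
  · refine (homologyπ_surjective _ a).comp fun z => ?_
    obtain ⟨x, hx⟩ := ssMk_surjective (C := C) (F := F) (ε := ε) r a.1 (a.1 + a.2)
      (((ssPage C F ε r).iCycles a).hom z)
    have hd := d_iCycles_apply (ssPage C F ε r) a b z
    rw [← hx] at hd
    obtain ⟨x', hx', hxx⟩ := exists_mem_ssCycles_succ hF hb1 hb2 x.2
      ((ssPage_d_ssMk_eq_zero_iff hb x).1 hd)
    refine ⟨⟨x', hx'⟩, iCycles_injective _ a ?_⟩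
    rw [hl, ← hx]
    exact (ssMk_eq_iff r _ _ ⟨x', _⟩ x).2 (by rwa [← neg_mem_iff, neg_sub])
  · intro x
    change ((ssPage C F ε r).homologyπ a).hom (l.hom x) = 0 ↔ _
    rw [homologyπ_eq_zero_iff _ hprev, mem_ssBoundaries_succ_iff hF he1 he2 x.2, hl,
      ssPage_d he he1 he2]
    constructor
    · rintro ⟨w, hw⟩
      obtain ⟨v, rfl⟩ := ssMk_surjective (C := C) (F := F) (ε := ε) r e.1 (e.1 + e.2) w
      exact ⟨v.1, v.2, (ssMk_eq_iff r a.1 (a.1 + a.2) (ssDiffCycles C F ε r _ _ _ _ he1 he2 v)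
        (AddSubgroup.inclusion (ssCycles_succ_le hF r _ _) x)).1 hw⟩
    · rintro ⟨v, hv, h⟩
      exact ⟨ssMk C F ε r _ _ ⟨v, hv⟩, (ssMk_eq_iff r a.1 (a.1 + a.2)
        (ssDiffCycles C F ε r _ _ _ _ he1 he2 ⟨v, hv⟩)
        (AddSubgroup.inclusion (ssCycles_succ_le hF r _ _) x)).2 h⟩
  · intro x x' hxx z hz
    have : l.hom x' = z := iCycles_injective _ a (by
      rw [hl, hz]
      exact congrArg (ssMk C F ε r _ _) (Subtype.ext hxx.symm))
    rw [← this]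
    rfl

/-- The homology of a page is the next page. -/
theorem exists_ssPage_iso (hF : ∀ p n, F (p + ε) n ≤ F p n) (r : ℤ) (a : ℤ × ℤ) :
    ∃ i : (ssPage C F ε r).homology a ≅ (ssPage C F ε (r + 1)).X a,
      ∀ (x : ssCycles C F ε r a.1 (a.1 + a.2)) (x' : ssCycles C F ε (r + 1) a.1 (a.1 + a.2)),
        x.1 = x'.1 → ∀ z : (ssPage C F ε r).cycles a,
          ((ssPage C F ε r).iCycles a).hom z = ssMk C F ε r a.1 (a.1 + a.2) x →
          i.hom.hom (((ssPage C F ε r).homologyπ a).hom z) =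
            ssMk C F ε (r + 1) a.1 (a.1 + a.2) x' := by
  obtain ⟨g, hg, hg0, hgz⟩ := exists_ssPage_homology_hom hF r a
  have hker : g.ker = (ssBoundaries C F ε (r + 1) a.1 (a.1 + a.2)).addSubgroupOf
      (ssCycles C F ε (r + 1) a.1 (a.1 + a.2)) := by
    ext x
    rw [AddMonoidHom.mem_ker, hg0, AddSubgroup.mem_addSubgroupOf]
  let i := (QuotientAddGroup.quotientKerEquivOfSurjective g hg).symm.trans
    (QuotientAddGroup.quotientAddEquivOfEq hker)
  refine ⟨AddEquiv.toAddCommGrpIso (X := (ssPage C F ε r).homology a)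
    (Y := (ssPage C F ε (r + 1)).X a) i, ?_⟩
  intro x x' hxx z hz
  rw [hgz x x' hxx z hz]
  change QuotientAddGroup.quotientAddEquivOfEq hker
    ((QuotientAddGroup.quotientKerEquivOfSurjective g hg).symm (g x')) = _
  have : (QuotientAddGroup.quotientKerEquivOfSurjective g hg).symm (g x') = (x' : _ ⧸ g.ker) :=
    (AddEquiv.symm_apply_eq _).2 rfl
  rw [this]
  rfl

/-- The spectral sequence of a filtered complex. -/
theorem exists_isInducedBy (hF : ∀ p n, F (p + ε) n ≤ F p n) {c' : ℤ → ComplexShape (ℤ × ℤ)}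
    (hc' : ∀ r, c' r = ComplexShape.up' (ε * r, ε * (1 - r))) :
    ∃ E : SpectralSequence AddCommGrpCat.{v} c' 0, Nonempty (IsInducedBy C F ε E) := by
  obtain rfl : c' = fun r => ComplexShape.up' (ε * r, ε * (1 - r)) := funext hc'
  choose i hi using exists_ssPage_iso (C := C) hF
  refine ⟨{ page := fun r _ => ssPage C F ε r
            iso := fun r r' a h _ => by subst h; exact i r a }, ⟨?_⟩⟩
  exact
    { cls := fun r _ p s => ssMk C F ε r p (p + s)
      cls_surjective := fun r _ p s => ssMk_surjective r p (p + s)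
      cls_eq_zero_iff := fun r _ p s x => ssMk_eq_zero_iff r p (p + s) x
      d_cls := by
        intro r _ p s x y hxy
        have hp : p + ε * r = p + ε * r := rfl
        have hn : p + s + ε = p + ε * r + (s + ε * (1 - r)) := by ring
        change ((ssPage C F ε r).d (p, s) (p + ε * r, s + ε * (1 - r))).hom _ = _
        rw [ssPage_d (a := (p, s)) (b := (p + ε * r, s + ε * (1 - r))) rfl hp hn]
        exact congrArg (ssMk C F ε r _ _) (Subtype.ext hxy.symm)
      iso_cls := by
        intro r _ p s x x' hx z hz
        exact hi r (p, s) x x' hx z hz }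

end Pages

/-! ### Convergence of a finite filtration, and the first page. -/

section Convergence

variable {c : ComplexShape ℤ} {C : HomologicalComplex AddCommGrpCat.{v} c}
  {F : ℤ → (n : ℤ) → AddSubgroup (C.X n)} {ε : ℤ}
  {c' : ℤ → ComplexShape (ℤ × ℤ)} {E : SpectralSequence AddCommGrpCat.{v} c' 0}

/-- A position of the spectral sequence where the filtration does not jump is zero. -/
theorem IsInducedBy.eq_zero (hE : IsInducedBy C F ε E) {r : ℤ} (hr : 0 ≤ r) {p s : ℤ}
    (hp : F p (p + s) ≤ F (p + ε) (p + s)) (x : (E.page r hr).X (p, s)) : x = 0 := by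
  obtain ⟨y, rfl⟩ := hE.cls_surjective r hr p s x
  refine (hE.cls_eq_zero_iff r hr p s y).2 (AddSubgroup.mem_sup_left ?_)
  refine (mem_ssCycles rfl (p' := p + ε * r) (by ring)).2 ⟨hp y.2.1, y.2.2⟩

variable (C F) in
/-- The filtration of the homology by the classes of the cycles in `F p`. -/
def cycleFil (p n : ℤ) : AddSubgroup (C.homology n) :=
  ((F p n).comap (C.iCycles n).hom).map (C.homologyπ n).hom

theorem cycleFil_eq_top {p n : ℤ} (h : F p n = ⊤) : cycleFil C F p n = ⊤ := by
  rw [cycleFil, h, AddSubgroup.comap_top, ← AddMonoidHom.range_eq_map]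
  exact AddMonoidHom.range_eq_top.2 (homologyπ_surjective C n)

theorem cycleFil_eq_bot {p n : ℤ} (h : F p n = ⊥) : cycleFil C F p n = ⊥ := by
  rw [cycleFil, h, eq_bot_iff]
  rintro _ ⟨z, hz, rfl⟩
  have : z = 0 := iCycles_injective C n (by rw [map_zero]; exact hz)
  rw [this, map_zero]
  exact zero_mem _

theorem cycleFil_mono {p p' n : ℤ} (h : F p n ≤ F p' n) : cycleFil C F p n ≤ cycleFil C F p' n :=
  AddSubgroup.map_mono (AddSubgroup.comap_mono h)

/-- The limit page of a finite filtration. -/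
theorem IsInducedBy.nonempty_limit (hE : IsInducedBy C F ε E) (hF : ∀ p n, F (p + ε) n ≤ F p n)
    (hc : ∀ i, c.Rel i (i + ε)) {r : ℤ} (hr : 0 ≤ r) (p s : ℤ)
    (hp : F (p + ε * r) (p + s + ε) = ⊥ ∨ F p (p + s) ≤ F (p + ε) (p + s))
    (hp' : F (p - ε * (r - 1)) (p + s - ε) = ⊤ ∨ F p (p + s) ≤ F (p + ε) (p + s)) :
    Nonempty ((E.page r hr).X (p, s) ≃+ (cycleFil C F p (p + s) ⧸
      (cycleFil C F (p + ε) (p + s)).addSubgroupOf (cycleFil C F p (p + s)))) := by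
  have hnext : c.next (p + s) = p + s + ε := c.next_eq' (hc _)
  have hprev : c.prev (p + s) = p + s - ε := c.prev_eq' (by simpa using hc (p + s - ε))
  -- If the filtration does not jump at `p`, both sides are zero, hence both are quotients of the
  -- trivial group.
  by_cases htriv : F p (p + s) ≤ F (p + ε) (p + s)
  · refine nonempty_addEquiv_of_surjective (A := PUnit.{1}) 0 0 (fun x => ⟨0, ?_⟩)
      (fun x => ⟨0, ?_⟩) (fun x => by simp)
    · exact (hE.eq_zero hr htriv x).symm
    · obtain ⟨x, rfl⟩ := QuotientAddGroup.mk_surjective x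
      refine ((QuotientAddGroup.eq_zero_iff _).2 ?_).symm
      exact AddSubgroup.mem_addSubgroupOf.2 (cycleFil_mono htriv x.2)
  replace hp := hp.resolve_right htriv
  replace hp' := hp'.resolve_right htriv
  -- Both sides are quotients of the group `Z` of cycles in `F p`: the target of the differential
  -- condition is zero by `hp`, so `Z^r_p` consists of cycles, and by `hp'` any chain may serve as a
  -- bounding chain provided its boundary lies in `F p`.
  let Z : AddSubgroup (C.cycles (p + s)) := (F p (p + s)).comap (C.iCycles _).hom
  let f : Z →+ ssCycles C F ε r p (p + s) :=
    ((C.iCycles _).hom.comp Z.subtype).codRestrict _ fun z =>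
      ⟨z.2, by
        change (C.d (p + s) (p + s + ε)).hom ((C.iCycles _).hom z.1) ∈
          F (p + ε * r) (p + s + ε)
        rw [d_iCycles_apply]
        exact zero_mem _⟩
  let g : Z →+ cycleFil C F p (p + s) :=
    ((C.homologyπ _).hom.comp Z.subtype).codRestrict _ fun z => ⟨z.1, z.2, rfl⟩
  have hf : Function.Surjective f := by
    rintro ⟨x, hx⟩
    obtain ⟨z, hz⟩ := exists_iCycles_eq C hnext (x := x) (by
      have := hx.2
      rw [hp] at this
      exact this)
    refine ⟨⟨z, ?_⟩, Subtype.ext hz⟩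
    change (C.iCycles _).hom z ∈ F p (p + s)
    rw [hz]
    exact hx.1
  have hg : Function.Surjective g := by
    rintro ⟨_, z, hz, rfl⟩
    exact ⟨⟨z, hz⟩, rfl⟩
  refine nonempty_addEquiv_of_surjective ((hE.cls r hr p s).comp f)
    ((QuotientAddGroup.mk' _).comp g) ((hE.cls_surjective r hr p s).comp hf)
    ((QuotientAddGroup.mk'_surjective _).comp hg) fun z => ?_
  change hE.cls r hr p s (f z) = 0 ↔ QuotientAddGroup.mk (s := (cycleFil C F (p + ε) (p + s)).addSubgroupOf _) (g z) = 0
  rw [hE.cls_eq_zero_iff, QuotientAddGroup.eq_zero_iff, AddSubgroup.mem_addSubgroupOf,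
    mem_ssBoundaries (m := p + s - ε) (by ring) rfl]
  change (∃ y ∈ ssCycles C F ε (r - 1) (p + ε) (p + s),
      ∃ w ∈ ssCycles C F ε (r - 1) (p - ε * (r - 1)) (p + s - ε),
        y + (C.d (p + s - ε) (p + s)).hom w = (C.iCycles _).hom z.1) ↔
    (C.homologyπ _).hom z.1 ∈ cycleFil C F (p + ε) (p + s)
  constructor
  · rintro ⟨y, hy, w, -, hyw⟩
    obtain ⟨z', hz'⟩ := exists_iCycles_eq C hnext (x := y) (by
      have := d_iCycles_apply C (p + s) (p + s + ε) z.1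
      rwa [← hyw, map_add, d_d_apply, add_zero] at this)
    refine ⟨z', ?_, ?_⟩
    · change (C.iCycles _).hom z' ∈ F (p + ε) (p + s)
      rw [hz']
      exact hy.1
    · rw [eq_comm, ← sub_eq_zero, ← map_sub, homologyπ_eq_zero_iff C hprev]
      exact ⟨w, by rw [map_sub, ← hyw, hz', add_sub_cancel_left]⟩
  · rintro ⟨z', hz', h⟩
    rw [eq_comm, ← sub_eq_zero, ← map_sub, homologyπ_eq_zero_iff C hprev] at h
    obtain ⟨w, hw⟩ := h
    rw [map_sub] at hw
    refine ⟨(C.iCycles _).hom z', (mem_ssCycles rfl rfl).2 ⟨hz', ?_⟩, w, ?_, ?_⟩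
    · rw [d_iCycles_apply]
      exact zero_mem _
    · refine (mem_ssCycles (m := p + s) (by ring) (p' := p) (by ring)).2 ⟨?_, ?_⟩
      · rw [hp']
        exact AddSubgroup.mem_top _
      · rw [hw]
        exact sub_mem z.2 (hF _ _ hz')
    · rw [hw, add_sub_cancel]

/-- The spectral sequence of a finite filtration converges. -/
theorem IsInducedBy.convergesTo (hE : IsInducedBy C F ε E) (hF : ∀ p n, F (p + ε) n ≤ F p n)
    (hc : ∀ i, c.Rel i (i + ε)) (hc' : ∀ r, c' r = ComplexShape.up' (ε * r, ε * (1 - r)))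
    (hε : ε * ε = 1) (a : ℤ) (N : ℕ)
    (htop : ∀ p n, ε * (p - a) ≤ 0 → F p n = ⊤) (hbot : ∀ p n, N ≤ ε * (p - a) → F p n = ⊥) :
    ConvergesTo ε E N (fun n => C.homology n) (cycleFil C F) := by
  -- The integer `ε * (p - a)` is the depth in the filtration: everything at depth at most `0`, zero
  -- at depth at least `N`. A shift by `ε k` adds `k` to the depth, by `ε * ε = 1`.
  have hstep (p k : ℤ) : ε * (p + ε * k - a) = ε * (p - a) + k := by
    linear_combination k * hε
  have htriv (p n : ℤ) (h : ε * (p - a) < 0 ∨ N ≤ ε * (p - a)) : F p n ≤ F (p + ε) n := by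
    rcases h with h | h
    · rw [htop (p + ε)]
      · exact le_top
      · have := hstep p 1
        rw [mul_one] at this
        lia
    · rw [hbot p n h]
      exact bot_le
  refine ⟨fun p n => cycleFil_mono (hF p n), fun n => ⟨a, cycleFil_eq_top (htop _ _ ?_)⟩,
    fun n => ⟨a + ε * N, cycleFil_eq_bot (hbot _ _ ?_)⟩, ?_, ?_⟩
  · simp
  · rw [hstep]; simp
  · rintro r hr hN ⟨p, s⟩ ⟨p', s'⟩
    by_cases hrel : (c' r).Rel (p, s) (p', s')
    · rw [hc'] at hrel
      have hp' : p + ε * r = p' := congrArg Prod.fst hrel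
      have hs := hstep p r
      rw [hp'] at hs
      refine AddCommGrpCat.hom_ext (AddMonoidHom.ext fun x => ?_)
      -- A differential of length `r ≥ N` starts at negative depth or ends at depth at least `N`;
      -- its source or its target vanishes.
      by_cases h : ε * (p - a) < 0
      · rw [hE.eq_zero hr (htriv _ _ (Or.inl h)) x, map_zero]
        rfl
      · exact hE.eq_zero hr (htriv _ _ (Or.inr (by lia))) _
    · exact (E.page r hr).shape _ _ hrel
  · intro r hr hN p s
    refine hE.nonempty_limit hF hc hr p s ?_ ?_
    · by_cases h : ε * (p - a) < 0
      · exact Or.inr (htriv _ _ (Or.inl h))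
      · exact Or.inl (hbot _ _ (by rw [hstep]; lia))
    · by_cases h : (N : ℤ) ≤ ε * (p - a)
      · exact Or.inr (htriv _ _ (Or.inr h))
      · refine Or.inl (htop _ _ ?_)
        have := hstep p (-(r - 1))
        rw [show p - ε * (r - 1) = p + ε * (-(r - 1)) by ring]
        lia

/-- The first page is the homology of the graded pieces of the filtration. -/
theorem IsInducedBy.nonempty_first_page (hE : IsInducedBy C F ε E)
    {p s n m₀ m₂ : ℤ} (hn : p + s = n) (h₀ : m₀ + ε = n) (h₂ : n + ε = m₂)
    (hF : ∀ n, F (p + ε) n ≤ F p n)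
    (hd : ∀ n m x, x ∈ F p n → (C.d n m).hom x ∈ F p m)
    (hd' : ∀ n m x, x ∈ F (p + ε) n → (C.d n m).hom x ∈ F (p + ε) m)
    {M₀ M₁ M₂ : Type*} [AddCommGroup M₀] [AddCommGroup M₁] [AddCommGroup M₂]
    (α : M₀ →+ M₁) (β : M₁ →+ M₂) (ψ₀ : C.X m₀ →+ M₀) (ψ₁ : C.X n →+ M₁) (ψ₂ : C.X m₂ →+ M₂)
    (hs₀ : ∀ y, ∃ x ∈ F p m₀, ψ₀ x = y) (hs₁ : ∀ y, ∃ x ∈ F p n, ψ₁ x = y)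
    (hk₁ : ∀ x ∈ F p n, ψ₁ x = 0 ↔ x ∈ F (p + ε) n)
    (hk₂ : ∀ x ∈ F p m₂, ψ₂ x = 0 ↔ x ∈ F (p + ε) m₂)
    (hα : ∀ x ∈ F p m₀, ψ₁ ((C.d m₀ n).hom x) = α (ψ₀ x))
    (hβ : ∀ x ∈ F p n, ψ₂ ((C.d n m₂).hom x) = β (ψ₁ x)) :
    Nonempty ((E.page 1 zero_le_one).X (p, s) ≃+ β.ker ⧸ α.range.addSubgroupOf β.ker) := by
  subst hn
  -- On `F p` the kernel of `ψ₂` is `F (p + ε)`, so being in `Z^1_p` means that the image under `ψ₁`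
  -- is a cycle for `β`.
  have hmem (x : C.X (p + s)) :
      x ∈ ssCycles C F ε 1 p (p + s) ↔ x ∈ F p (p + s) ∧ β (ψ₁ x) = 0 := by
    rw [mem_ssCycles h₂ (p' := p + ε) (by ring)]
    refine and_congr_right fun hx => ?_
    rw [← hβ x hx, hk₂ _ (hd _ _ _ hx)]
  let g : ssCycles C F ε 1 p (p + s) →+ β.ker :=
    (ψ₁.comp (AddSubgroup.subtype _)).codRestrict _ fun x => ((hmem x.1).1 x.2).2
  refine nonempty_addEquiv_of_surjective (hE.cls 1 zero_le_one p s)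
    ((QuotientAddGroup.mk' _).comp g) (hE.cls_surjective 1 zero_le_one p s)
    ((QuotientAddGroup.mk'_surjective _).comp ?_) fun x => ?_
  · rintro ⟨y, hy⟩
    obtain ⟨x, hx, rfl⟩ := hs₁ y
    exact ⟨⟨x, (hmem x).2 ⟨hx, hy⟩⟩, rfl⟩
  change _ ↔ QuotientAddGroup.mk (s := α.range.addSubgroupOf β.ker) (g x) = 0
  have hx := ((hmem x.1).1 x.2).1
  rw [hE.cls_eq_zero_iff, QuotientAddGroup.eq_zero_iff, AddSubgroup.mem_addSubgroupOf,
    mem_ssBoundaries h₀ (p' := p) (by ring)]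
  change _ ↔ ∃ w, α w = ψ₁ x.1
  constructor
  · rintro ⟨y, hy, w, hw, hyw⟩
    refine ⟨ψ₀ w, ?_⟩
    rw [← hα w hw.1, ← hyw, map_add, (hk₁ y (hF _ hy.1)).2 hy.1, zero_add]
  · rintro ⟨w, hw⟩
    obtain ⟨w, hwF, rfl⟩ := hs₀ w
    rw [← hα w hwF] at hw
    have hy : x.1 - (C.d m₀ (p + s)).hom w ∈ F (p + ε) (p + s) := by
      rw [← hk₁ _ (sub_mem hx (hd _ _ _ hwF)), map_sub, hw, sub_self]
    refine ⟨_, (mem_ssCycles rfl (p' := p + ε) (by ring)).2 ⟨hy, hd' _ _ _ hy⟩, w,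
      (mem_ssCycles h₀ (p' := p) (by ring)).2 ⟨hwF, hd _ _ _ hwF⟩, sub_add_cancel _ _⟩

end Convergence

/-! ### Functions on cells, maps given by incidence matrices, and acyclic matchings. -/

section Cells

variable {V : Type u}

/-- The members of `A` of dimension `n`. -/
abbrev Cell (A : Set (Finset V)) (n : ℤ) : Type u :=
  {s : Finset V // s ∈ A ∧ (s.card : ℤ) = n + 1}

variable {G : Type v} [AddCommGroup G] {A B : Set (Finset V)} {n : ℤ}

open Classical in
/-- Extension by zero of a function on cells to all finite sets. -/
def cellExtend (c : Cell A n → G) (s : Finset V) : G :=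
  if h : s ∈ A ∧ (s.card : ℤ) = n + 1 then c ⟨s, h⟩ else 0

theorem cellExtend_val (c : Cell A n → G) (s : Cell A n) : cellExtend c s.1 = c s :=
  dif_pos s.2

theorem cellExtend_of_mem (c : Cell A n → G) {s : Finset V} (h : s ∈ A)
    (h' : (s.card : ℤ) = n + 1) : cellExtend c s = c ⟨s, h, h'⟩ :=
  dif_pos ⟨h, h'⟩

theorem cellExtend_of_notMem (c : Cell A n → G) {s : Finset V} (h : s ∉ A) :
    cellExtend c s = 0 :=
  dif_neg fun h' => h h'.1

theorem cellExtend_of_card_ne (c : Cell A n → G) {s : Finset V} (h : (s.card : ℤ) ≠ n + 1) :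
    cellExtend c s = 0 :=
  dif_neg fun h' => h h'.2

variable (G A B n) in
/-- Restriction of functions from `A` to `A ∩ B`, followed by extension by zero to `B`. -/
def cellTransfer : (Cell A n → G) →+ (Cell B n → G) where
  toFun c := fun t => cellExtend c t.1
  map_zero' := by
    ext t
    by_cases h : t.1 ∈ A ∧ (t.1.card : ℤ) = n + 1 <;> simp [cellExtend, h]
  map_add' a b := by
    ext t
    by_cases h : t.1 ∈ A ∧ (t.1.card : ℤ) = n + 1 <;> simp [cellExtend, h]

theorem cellTransfer_of_mem (c : Cell A n → G) (t : Cell B n) (ht : t.1 ∈ A) :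
    cellTransfer G A B n c t = c ⟨t.1, ht, t.2.2⟩ := cellExtend_of_mem c ht t.2.2

theorem cellTransfer_of_notMem (c : Cell A n → G) (t : Cell B n) (ht : t.1 ∉ A) :
    cellTransfer G A B n c t = 0 := cellExtend_of_notMem c ht

theorem cellExtend_cellTransfer_of_mem (c : Cell A n → G) {s : Finset V} (hs : s ∈ B) :
    cellExtend (cellTransfer G A B n c) s = cellExtend c s := by
  by_cases h : (s.card : ℤ) = n + 1
  · exact cellExtend_of_mem _ hs h
  · rw [cellExtend_of_card_ne _ h, cellExtend_of_card_ne _ h]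

variable [Fintype V]

instance instFintypeCell (A : Set (Finset V)) (n : ℤ) : Fintype (Cell A n) :=
  Fintype.ofFinite _

open Classical in
theorem sum_cell (f : Finset V → G) :
    ∑ s : Cell A n, f s.1 = ∑ s : Finset V, if s ∈ A ∧ (s.card : ℤ) = n + 1 then f s else 0 := by
  rw [← Finset.sum_filter]
  exact (Finset.sum_subtype _ (by simp) f).symm

theorem sum_cell_congr (f : Finset V → G) (hA : ∀ s ∈ A, s ∉ B → f s = 0)
    (hB : ∀ s ∈ B, s ∉ A → f s = 0) : ∑ s : Cell A n, f s.1 = ∑ s : Cell B n, f s.1 := by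
  classical
  rw [sum_cell, sum_cell]
  refine Finset.sum_congr rfl fun s _ => ?_
  by_cases h : (s.card : ℤ) = n + 1
  · by_cases h1 : s ∈ A <;> by_cases h2 : s ∈ B <;> simp [h, h1, h2, hA, hB]
  · simp [h]

variable (κ : Finset V → Finset V → ℤ)

variable (G A) in
/-- The additive map between functions on cells with matrix `κ`. -/
def cellMap (i j : ℤ) : (Cell A i → G) →+ (Cell A j → G) where
  toFun c := fun t => ∑ s : Cell A i, κ s.1 t.1 • c s
  map_zero' := by ext; simp
  map_add' a b := by ext; simp [Finset.sum_add_distrib]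

theorem cellMap_apply (i j : ℤ) (c : Cell A i → G) (t : Cell A j) :
    cellMap G A κ i j c t = ∑ s : Cell A i, κ s.1 t.1 • c s := rfl

theorem cellMap_eq_sum (i j : ℤ) (c : Cell A i → G) (t : Cell A j) :
    cellMap G A κ i j c t = ∑ s : Finset V, κ s t.1 • cellExtend c s := by
  classical
  rw [cellMap_apply]
  simp_rw [← cellExtend_val c]
  rw [sum_cell (fun s => κ s t.1 • cellExtend c s)]
  refine Finset.sum_congr rfl fun s _ => ?_
  split_ifs with h
  · rfl
  · rw [cellExtend, dif_neg h, smul_zero]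

/-- Entries of `κ` between cells of `A ∩ B` contribute equally to both sides. The discrepancy comes
from entries starting outside `B` or ending outside `A`, and these are required to meet a zero
coefficient. Quotient complexes, subcomplexes and graded pieces all satisfy this requirement. -/
theorem cellTransfer_cellMap {i j : ℤ} (c : Cell A i → G)
    (h : ∀ s ∈ A, ∀ t ∈ B, (t.card : ℤ) = j + 1 → κ s t ≠ 0 → ¬ (s ∈ B ∧ t ∈ A) →
      cellExtend c s = 0) :
    cellTransfer G A B j (cellMap G A κ i j c) = cellMap G B κ i j (cellTransfer G A B i c) := by
  ext t
  rw [cellMap_eq_sum]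
  by_cases ht : t.1 ∈ A
  · rw [cellTransfer_of_mem _ _ ht, cellMap_eq_sum]
    refine Finset.sum_congr rfl fun s _ => ?_
    by_cases hs : s ∈ B
    · rw [cellExtend_cellTransfer_of_mem c hs]
    · rw [cellExtend_of_notMem _ hs, smul_zero]
      by_cases hκ : κ s t.1 = 0
      · rw [hκ, zero_smul]
      · by_cases hsA : s ∈ A
        · rw [h s hsA t.1 t.2.1 t.2.2 hκ (fun h' => hs h'.1), smul_zero]
        · rw [cellExtend_of_notMem _ hsA, smul_zero]
  · rw [cellTransfer_of_notMem _ _ ht]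
    refine (Finset.sum_eq_zero fun s _ => ?_).symm
    by_cases hs : s ∈ B
    · rw [cellExtend_cellTransfer_of_mem c hs]
      by_cases hκ : κ s t.1 = 0
      · rw [hκ, zero_smul]
      · by_cases hsA : s ∈ A
        · rw [h s hsA t.1 t.2.1 t.2.2 hκ (fun h' => ht h'.2), smul_zero]
        · rw [cellExtend_of_notMem _ hsA, smul_zero]
    · rw [cellExtend_of_notMem _ hs, smul_zero]

variable (G A) in
/-- Kernel modulo image of two consecutive maps with matrix `κ`. -/
abbrev CellHomology (m₀ n m₂ : ℤ) : Type (max u v) :=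
  (cellMap G A κ n m₂).ker ⧸ (cellMap G A κ m₀ n).range.addSubgroupOf (cellMap G A κ n m₂).ker

theorem cellHomology_subsingleton {m₀ m₂ : ℤ}
    (h : ∀ c : Cell A n → G, cellMap G A κ n m₂ c = 0 → ∃ b, cellMap G A κ m₀ n b = c) :
    Subsingleton (CellHomology G A κ m₀ n m₂) := by
  have htop : (cellMap G A κ m₀ n).range.addSubgroupOf (cellMap G A κ n m₂).ker = ⊤ :=
    AddSubgroup.addSubgroupOf_eq_top.2 fun c hc => h c hc
  rw [CellHomology, htop]
  exact QuotientAddGroup.subsingleton_quotient_top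

variable {κ}

/-- An acyclic matching `σ` of the cells, with unit incidence numbers, makes them acyclic. -/
theorem exists_cellMap_eq {ε : ℤ} (σ : Finset V → Finset V) (P : Finset V → Prop)
    (hdeg : ∀ s t, κ s t ≠ 0 → (t.card : ℤ) = s.card + ε) (hσA : ∀ s ∈ A, σ s ∈ A)
    (hσP : ∀ s, P (σ s) ↔ ¬ P s) (hσσ : ∀ s, σ (σ s) = s)
    (hκ : ∀ s t, ¬ P s → P t → κ s t ≠ 0 → s = σ t)
    (hunit : ∀ t, P t → κ (σ t) t * κ (σ t) t = 1)
    (hcomp : ∀ s ∈ A, ∀ r ∈ A, ∀ j, ∑ t : Cell A j, κ s t.1 * κ t.1 r = 0)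
    {m₀ n m₂ : ℤ} (h₀ : m₀ + ε = n) (h₂ : n + ε = m₂) (c : Cell A n → G)
    (hc : cellMap G A κ n m₂ c = 0) : ∃ b : Cell A m₀ → G, cellMap G A κ m₀ n b = c := by
  classical
  have hne (t) (ht : P t) : κ (σ t) t ≠ 0 := fun h => by simpa [h] using hunit t ht
  -- The candidate primitive lives on the cells outside `P` and takes the value of `c` at the
  -- partner, corrected by the unit incidence number. At a cell of `P` only the partner contributes,
  -- so the image of `b` agrees with `c` there.
  let b : Cell A m₀ → G := fun u => if P u.1 then 0 else κ u.1 (σ u.1) • cellExtend c (σ u.1)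
  have hb (t : Cell A n) (ht : P t.1) : cellMap G A κ m₀ n b t = c t := by
    have hu : ((σ t.1).card : ℤ) = m₀ + 1 := by
      have h1 := hdeg _ _ (hne _ ht)
      have h2 := t.2.2
      lia
    rw [cellMap_apply, Finset.sum_eq_single ⟨σ t.1, hσA _ t.2.1, hu⟩]
    · have : ¬ P (σ t.1) := fun h => (hσP _).1 h ht
      simp only [b, if_neg this, hσσ, smul_smul, hunit _ ht, one_smul, cellExtend_val]
    · intro u _ hut
      by_cases hPu : P u.1
      · simp [b, hPu]
      · by_cases hκu : κ u.1 t.1 = 0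
        · simp [hκu]
        · exact absurd (Subtype.ext (hκ _ _ hPu ht hκu)) hut
    · simp
  refine ⟨b, ?_⟩
  -- The error is a cycle that vanishes on `P`. Evaluating its image at the partner `σ t` of a cell
  -- `t` outside `P` leaves only the term of `t`, which must therefore vanish too.
  let c' : Cell A n → G := c - cellMap G A κ m₀ n b
  have hc' : cellMap G A κ n m₂ c' = 0 := by
    rw [map_sub, hc, zero_sub, neg_eq_zero]
    ext r
    rw [cellMap_apply]
    simp only [cellMap_apply, Finset.smul_sum, smul_smul]
    rw [Finset.sum_comm]
    refine Finset.sum_eq_zero fun s _ => ?_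
    rw [← Finset.sum_smul]
    simp only [mul_comm (κ _ r.1)]
    rw [hcomp _ s.2.1 _ r.2.1, zero_smul]
  have hP (t : Cell A n) (ht : P t.1) : c' t = 0 := by
    change c t - cellMap G A κ m₀ n b t = 0
    rw [hb t ht, sub_self]
  suffices h : c' = 0 from (sub_eq_zero.1 h).symm
  ext t
  by_cases ht : P t.1
  · exact hP t ht
  have ht' : P (σ t.1) := (hσP _).2 ht
  have hu : ((σ t.1).card : ℤ) = m₂ + 1 := by
    have h1 := hdeg _ _ (hne _ ht')
    rw [hσσ] at h1
    have h2 := t.2.2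
    lia
  have := congrFun hc' ⟨σ t.1, hσA _ t.2.1, hu⟩
  rw [cellMap_apply, Finset.sum_eq_single t] at this
  · have h1 := hunit _ ht'
    rw [hσσ] at h1
    have h2 : (κ t.1 (σ t.1) * κ t.1 (σ t.1)) • c' t = 0 := by
      rw [mul_smul]
      exact (congrArg _ this).trans (smul_zero _)
    rwa [h1, one_smul] at h2
  · intro u _ hut
    by_cases hPu : P u.1
    · rw [hP u hPu, smul_zero]
    · by_cases hκu : κ u.1 (σ t.1) = 0
      · rw [hκu, zero_smul]
      · refine absurd (Subtype.ext ?_) hut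
        rw [hκ _ _ hPu ht' hκu, hσσ]
  · simp

end Cells

/-! ### Incidence numbers and toggling a vertex. -/

section Incidence

variable {V : Type u} [LinearOrder V]

theorem eq_insert_of_incidence_ne_zero {s t : Finset V} {w : V} (hs : w ∈ s) (ht : w ∉ t)
    (h : incidence s t ≠ 0) : s = insert w t := by
  obtain ⟨h1, h2⟩ := incidence_ne_zero h
  refine (Finset.eq_of_subset_of_card_le (Finset.insert_subset hs h1) ?_).symm
  rw [Finset.card_insert_of_notMem ht, h2]

theorem incidence_insert_mul_self {t : Finset V} {w : V} (ht : w ∉ t) :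
    incidence (insert w t) t * incidence (insert w t) t = 1 := by
  have := incidence_erase (Finset.mem_insert_self w t)
  rw [Finset.erase_insert ht] at this
  rw [this, ← mul_pow]
  simp

/-- The symmetric difference with a vertex. -/
def toggle (w : V) (s : Finset V) : Finset V := if w ∈ s then s.erase w else insert w s

theorem toggle_of_mem {w : V} {s : Finset V} (h : w ∈ s) : toggle w s = s.erase w := if_pos h

theorem toggle_of_notMem {w : V} {s : Finset V} (h : w ∉ s) : toggle w s = insert w s := if_neg h

theorem mem_toggle {w : V} {s : Finset V} : w ∈ toggle w s ↔ w ∉ s := by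
  by_cases h : w ∈ s <;> simp [toggle, h]

theorem toggle_toggle (w : V) (s : Finset V) : toggle w (toggle w s) = s := by
  by_cases h : w ∈ s <;> simp [toggle, h]

end Incidence

/-! ### The cells of a tile, and the acyclicity of tiles that are not critical. -/

namespace MorseTile

variable {V : Type u} (T : MorseTile V)

/-- The faces of the closure of a tile whose open simplices make up the tile. -/
def cells : Set (Finset V) := {s | s ⊆ T.simplex ∧ T.removed ⊆ s ∧ ¬ s ⊆ T.morseFace}

variable {T}

theorem nonempty_of_mem_cells {s : Finset V} (h : s ∈ T.cells) : s.Nonempty := by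
  rw [Finset.nonempty_iff_ne_empty]
  rintro rfl
  exact h.2.2 (Finset.empty_subset _)

theorem cells_subset_closure : T.cells ⊆ T.closure.faces :=
  fun _ hs => ⟨nonempty_of_mem_cells hs, hs.1⟩

theorem mem_complement_iff {s : Finset V} (hs : s ∈ T.closure.faces) :
    s ∈ T.complement.faces ↔ s ∉ T.cells := by
  constructor
  · rintro ⟨-, -, ⟨w, hw, hws⟩ | h⟩ ⟨-, h1, h2⟩
    · exact hws (h1 hw)
    · exact h2 h
  · intro h
    refine ⟨hs.1, hs.2, ?_⟩
    by_cases h1 : T.removed ⊆ s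
    · exact Or.inr (by_contra fun h2 => h ⟨hs.2, h1, h2⟩)
    · exact Or.inl (Finset.not_subset.1 h1)

theorem mem_cells_of_subset {r s t : Finset V} (hr : r ∈ T.cells) (hs : s ∈ T.cells) (hrt : r ⊆ t)
    (hts : t ⊆ s) : t ∈ T.cells :=
  ⟨hts.trans hs.1, hr.2.1.trans hrt, fun h => hr.2.2 (hrt.trans h)⟩

variable [LinearOrder V]

/-- If the Morse face is empty, some facet is removed but not all are; any vertex outside `removed`
works, since a cell keeps containing the nonempty set `removed`. If it is nonempty, it strictly
contains `removed`; a vertex of the difference affects neither the inclusion of `removed` nor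
whether the cell lies in the Morse face. -/
theorem exists_toggle_mem_cells (hT : ¬ T.IsCritical) :
    ∃ w, ∀ s ∈ T.cells, toggle w s ∈ T.cells := by
  rw [IsCritical, not_or] at hT
  obtain ⟨h1, h2⟩ := hT
  rcases T.morseFace.eq_empty_or_nonempty with hμ | hμ
  · have hne : T.removed ≠ T.simplex := fun h => h2 (congrArg Finset.card h)
    obtain ⟨w, hw, hwR⟩ := Finset.exists_of_ssubset (T.removed_subset.ssubset_of_ne hne)
    refine ⟨w, fun s hs => ?_⟩
    have hR : T.removed.Nonempty := by
      rw [Finset.nonempty_iff_ne_empty]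
      intro h
      simp [hμ, order, h] at h1
    have hsub : T.removed ⊆ toggle w s := by
      by_cases hws : w ∈ s
      · rw [toggle_of_mem hws]
        exact Finset.subset_erase.2 ⟨hs.2.1, hwR⟩
      · rw [toggle_of_notMem hws]
        exact hs.2.1.trans (Finset.subset_insert _ _)
    refine ⟨?_, hsub, ?_⟩
    · by_cases hws : w ∈ s
      · rw [toggle_of_mem hws]
        exact (Finset.erase_subset _ _).trans hs.1
      · rw [toggle_of_notMem hws]
        exact Finset.insert_subset hw hs.1
    · rw [hμ, Finset.subset_empty]
      exact (hR.mono hsub).ne_empty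
  · have hRμ := T.removed_subset_morseFace hμ
    have hne : T.removed ≠ T.morseFace := fun h => h1 (congrArg Finset.card h.symm)
    obtain ⟨w, hw, hwR⟩ := Finset.exists_of_ssubset (hRμ.ssubset_of_ne hne)
    refine ⟨w, fun s hs => ?_⟩
    by_cases hws : w ∈ s
    · rw [toggle_of_mem hws]
      refine ⟨(Finset.erase_subset _ _).trans hs.1, Finset.subset_erase.2 ⟨hs.2.1, hwR⟩,
        fun h => hs.2.2 ?_⟩
      rw [← Finset.insert_erase hws]
      exact Finset.insert_subset hw h
    · rw [toggle_of_notMem hws]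
      exact ⟨Finset.insert_subset (T.morseFace_subset hw) hs.1,
        hs.2.1.trans (Finset.subset_insert _ _),
        fun h => hs.2.2 ((Finset.subset_insert _ _).trans h)⟩

variable [Fintype V]

/-- Cells are convex in the face order: a face between two cells is a cell. Hence the terms in the
closed simplex that are not cells contribute nothing, and the vanishing is inherited from there. -/
theorem sum_cells_incidence {s r : Finset V} (hs : s ∈ T.cells) (hr : r ∈ T.cells) (j : ℤ) :
    ∑ t : Cell T.cells j, incidence s t.1 * incidence t.1 r = 0 := by
  by_cases hj : (r.card : ℤ) = j
  · rw [sum_cell_congr (A := T.cells) (B := T.closure.faces)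
      (fun t => incidence s t * incidence t r)]
    · exact sum_incidence T.closure j (cells_subset_closure hs) (nonempty_of_mem_cells hr) hj
    · exact fun t ht ht' => absurd (cells_subset_closure ht) ht'
    · intro t _ ht
      by_contra hne
      obtain ⟨h1, h2⟩ := mul_ne_zero_iff.1 hne
      exact ht (mem_cells_of_subset hr hs (incidence_ne_zero h2).1 (incidence_ne_zero h1).1)
  · refine Finset.sum_eq_zero fun t _ => ?_
    have : incidence t.1 r = 0 := by
      by_contra hne
      have h1 := (incidence_ne_zero hne).2
      have h2 := t.2.2
      lia
    rw [this, mul_zero]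

variable (G : Type v) [AddCommGroup G]

theorem cellHomology_incidence_subsingleton (hT : ¬ T.IsCritical) {m₀ n m₂ : ℤ}
    (h₀ : m₀ + -1 = n) (h₂ : n + -1 = m₂) :
    Subsingleton (CellHomology G T.cells incidence m₀ n m₂) := by
  obtain ⟨w, hw⟩ := exists_toggle_mem_cells hT
  refine cellHomology_subsingleton _ fun c hc =>
    exists_cellMap_eq (toggle w) (fun s => w ∉ s) (fun s t h => ?_) hw
      (fun s => by rw [mem_toggle]) (toggle_toggle w)
      (fun s t hs ht h => ?_) (fun t ht => ?_) (fun s hs r hr j => sum_cells_incidence hs hr j)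
      h₀ h₂ c hc
  · rw [(incidence_ne_zero h).2]
    push_cast
    ring
  · rw [toggle_of_notMem ht]
    exact eq_insert_of_incidence_ne_zero (not_not.1 hs) ht h
  · rw [toggle_of_notMem ht]
    exact incidence_insert_mul_self ht

theorem cellHomology_flip_incidence_subsingleton (hT : ¬ T.IsCritical) {m₀ n m₂ : ℤ}
    (h₀ : m₀ + 1 = n) (h₂ : n + 1 = m₂) :
    Subsingleton (CellHomology G T.cells (flip incidence) m₀ n m₂) := by
  obtain ⟨w, hw⟩ := exists_toggle_mem_cells hT
  refine cellHomology_subsingleton _ fun c hc =>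
    -- Coboundaries add vertices, so the matching is the same as for chains but the targets are now
    -- the cells containing `w`.
    exists_cellMap_eq (toggle w) (fun s => w ∈ s) (fun s t h => ?_) hw
      (fun s => mem_toggle) (toggle_toggle w)
      (fun s t hs ht h => ?_) (fun t ht => ?_) (fun s hs r hr j => ?_) h₀ h₂ c hc
  · rw [(incidence_ne_zero (show incidence t s ≠ 0 from h)).2]
    push_cast
    ring
  · rw [toggle_of_mem ht, eq_insert_of_incidence_ne_zero ht hs h, Finset.erase_insert hs]
  · rw [toggle_of_mem ht]
    have := incidence_insert_mul_self (Finset.notMem_erase w t)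
    rwa [Finset.insert_erase ht] at this
  · rw [← sum_cells_incidence hr hs j]
    exact Finset.sum_congr rfl fun t _ => mul_comm _ _

end MorseTile

/-! ### Kernels and cokernels of chain maps, degree by degree. -/

section Relative

variable {ι : Type*} {c : ComplexShape ι} {A B : HomologicalComplex AddCommGrpCat.{v} c}
  (φ : A ⟶ B) (n : ι)

theorem cokernelπ_f_surjective : Function.Surjective ((cokernel.π φ).f n).hom := by
  have : Epi ((cokernel.π φ).f n) :=
    inferInstanceAs (Epi ((HomologicalComplex.eval _ _ n).map (cokernel.π φ)))
  exact (AddCommGrpCat.epi_iff_surjective _).1 this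

theorem cokernelπ_f_eq_zero_iff (x : B.X n) :
    ((cokernel.π φ).f n).hom x = 0 ↔ x ∈ (φ.f n).hom.range := by
  have h := (ShortComplex.exact_cokernel φ).map (HomologicalComplex.eval _ _ n)
  constructor
  · exact (ShortComplex.ab_exact_iff _).1 h x
  · rintro ⟨y, rfl⟩
    exact congrArg (fun f : A.X n ⟶ (cokernel φ).X n => f.hom y)
      (HomologicalComplex.congr_hom (cokernel.condition φ) n)

theorem kernelι_f_injective : Function.Injective ((kernel.ι φ).f n).hom := by
  have : Mono ((kernel.ι φ).f n) :=
    inferInstanceAs (Mono ((HomologicalComplex.eval _ _ n).map (kernel.ι φ)))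
  exact (AddCommGrpCat.mono_iff_injective _).1 this

theorem range_kernelι_f : ((kernel.ι φ).f n).hom.range = (φ.f n).hom.ker := by
  have h := (ShortComplex.exact_kernel φ).map (HomologicalComplex.eval _ _ n)
  exact ShortComplex.ab_exact_iff_range_eq_ker.1 h

end Relative

/-! ### The first page and the relative groups of a tile, in terms of cells. -/

section Relative

variable {V : Type u} {G : Type v} [AddCommGroup G] {A B : Set (Finset V)} {n : ℤ}

theorem cellTransfer_cellTransfer_of_subset (h : ∀ s ∈ A, (s.card : ℤ) = n + 1 → s ∈ B)
    (c : Cell A n → G) : cellTransfer G B A n (cellTransfer G A B n c) = c := by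
  ext t
  have ht := h t.1 t.2.1 t.2.2
  exact (cellTransfer_of_mem _ _ ht).trans (cellTransfer_of_mem _ ⟨t.1, ht, t.2.2⟩ t.2.1)

theorem cellTransfer_eq_zero_iff (h : ∀ s ∈ A, (s.card : ℤ) = n + 1 → s ∈ B) (c : Cell B n → G) :
    cellTransfer G B A n c = 0 ↔ ∀ s : Cell B n, s.1 ∈ A → c s = 0 := by
  constructor
  · intro hc s hs
    exact (cellTransfer_of_mem c ⟨s.1, hs, s.2.2⟩ s.2.1).symm.trans (congrFun hc _)
  · intro hc
    ext t
    exact (cellTransfer_of_mem _ _ (h _ t.2.1 t.2.2)).trans (hc _ t.2.1)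

variable (G) {K L : PreAbstractSimplicialComplex V}

theorem chainExt_of_mem (h : L ≤ K) (c : Face L n → G) (s : Face K n) (hs : s.1 ∈ L.faces) :
    chainExt G h n c s = c ⟨s.1, hs, s.2.2⟩ := dif_pos hs

theorem chainExt_of_notMem (h : L ≤ K) (c : Face L n → G) (s : Face K n) (hs : s.1 ∉ L.faces) :
    chainExt G h n c s = 0 := dif_neg hs

variable (h : L ≤ K)

theorem chainExt_injective (n : ℤ) : Function.Injective (chainExt G h n) := by
  intro a b hab
  ext s
  have := congrFun hab (faceIncl h s)
  rwa [chainExt_of_mem G h a _ s.2.1, chainExt_of_mem G h b _ s.2.1] at this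

theorem mem_range_chainExt_iff (n : ℤ) (c : Face K n → G) :
    c ∈ (chainExt G h n).range ↔ ∀ s : Face K n, s.1 ∉ L.faces → c s = 0 := by
  constructor
  · rintro ⟨b, rfl⟩ s hs
    exact chainExt_of_notMem G h b s hs
  · intro hc
    refine ⟨fun s => c (faceIncl h s), ?_⟩
    ext s
    by_cases hs : s.1 ∈ L.faces
    · exact chainExt_of_mem G h _ s hs
    · exact (chainExt_of_notMem G h _ s hs).trans (hc s hs).symm

variable [Fintype V]

/-- The first page of the spectral sequence of a complex of functions on cells, filtered by
support. -/
theorem IsInducedBy.nonempty_first_page_cells {c : ComplexShape ℤ}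
    {C : HomologicalComplex AddCommGrpCat.{max u v} c} {F : ℤ → (n : ℤ) → AddSubgroup (C.X n)}
    {ε : ℤ} {c' : ℤ → ComplexShape (ℤ × ℤ)}
    {E : SpectralSequence AddCommGrpCat.{max u v} c' 0} (hE : IsInducedBy C F ε E)
    {κ : Finset V → Finset V → ℤ} (e : ∀ n, C.X n ≃+ (Cell B n → G))
    (he : ∀ i j x, e j ((C.d i j).hom x) = cellMap G B κ i j (e i x)) (W : ℤ → Set (Finset V))
    (hFW : ∀ p n x, x ∈ F p n ↔ ∀ s : Cell B n, s.1 ∉ W p → e n x s = 0)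
    (hW : ∀ p, ∀ s ∈ B, ∀ t ∈ B, κ s t ≠ 0 → s ∈ W p → t ∈ W p)
    (hF : ∀ p n, F (p + ε) n ≤ F p n) {p : ℤ} (A : Set (Finset V))
    (hA : ∀ s ∈ B, s ∈ A ↔ s ∈ W p ∧ s ∉ W (p + ε)) {s n m₀ m₂ q : ℤ} (hn : p + s = n)
    (h₀ : m₀ + ε = n) (h₂ : n + ε = m₂) (hAB : ∀ s ∈ A, (s.card : ℤ) ≤ q + 1 → s ∈ B)
    (hm₀ : m₀ ≤ q) (hnq : n ≤ q) (hm₂ : m₂ ≤ q) :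
    Nonempty ((E.page 1 zero_le_one).X (p, s) ≃+ CellHomology G A κ m₀ n m₂) := by
  have hd (p i j : ℤ) (x) (hx : x ∈ F p i) : (C.d i j).hom x ∈ F p j := by
    rw [hFW] at hx ⊢
    intro t ht
    rw [he, cellMap_apply]
    refine Finset.sum_eq_zero fun s _ => ?_
    by_cases hκ : κ s.1 t.1 = 0
    · rw [hκ, zero_smul]
    · rw [hx s (fun hs => ht (hW p s.1 s.2.1 t.1 t.2.1 hκ hs)), smul_zero]
  -- `A` may have cells of dimension above `q` that are missing from `B`; the comparison with the
  -- graded piece is restricted to degrees at most `q`.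
  have hAB' {m : ℤ} (hm : m ≤ q) (s) (hs : s ∈ A) (hsm : (s.card : ℤ) = m + 1) : s ∈ B :=
    hAB s hs (by lia)
  let ψ (m : ℤ) : C.X m →+ (Cell A m → G) := (cellTransfer G B A m).comp (e m).toAddMonoidHom
  have hs (m : ℤ) (hm : m ≤ q) (y : Cell A m → G) : ∃ x ∈ F p m, ψ m x = y := by
    refine ⟨(e m).symm (cellTransfer G A B m y), (hFW _ _ _).2 fun s hs => ?_, ?_⟩
    · rw [AddEquiv.apply_symm_apply]
      exact cellTransfer_of_notMem _ _ fun hsA => hs ((hA _ s.2.1).1 hsA).1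
    · change cellTransfer G B A m (e m _) = y
      rw [AddEquiv.apply_symm_apply, cellTransfer_cellTransfer_of_subset (hAB' hm)]
  have hk (m : ℤ) (hm : m ≤ q) (x) (hx : x ∈ F p m) : ψ m x = 0 ↔ x ∈ F (p + ε) m := by
    refine (cellTransfer_eq_zero_iff (hAB' hm) _).trans ?_
    rw [hFW] at hx ⊢
    refine forall_congr' fun s => ⟨fun h hs => ?_, fun h hs => h ((hA _ s.2.1).1 hs).2⟩
    by_cases hs' : s.1 ∈ W p
    · exact h ((hA _ s.2.1).2 ⟨hs', hs⟩)
    · exact hx s hs'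
  have hcomm (i j : ℤ) (hj : j ≤ q) (x) (hx : x ∈ F p i) :
      ψ j ((C.d i j).hom x) = cellMap G A κ i j (ψ i x) := by
    change cellTransfer G B A j (e j _) = cellMap G A κ i j (cellTransfer G B A i (e i x))
    rw [he]
    refine cellTransfer_cellMap _ _ fun s hs t ht htj hκ hst => ?_
    by_cases hcard : (s.card : ℤ) = i + 1
    · have htB := hAB' hj t ht htj
      rw [cellExtend_of_mem _ hs hcard]
      -- A cell of `W p` outside `A` lies in `W (p + ε)`, which is closed under nonzero entries of
      -- `κ`; it cannot reach `t`, which lies outside `W (p + ε)`.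
      refine (hFW _ _ _).1 hx _ fun hsW => hst ⟨(hA s hs).2 ⟨hsW, fun hsW' => ?_⟩, htB⟩
      exact ((hA t htB).1 ht).2 (hW _ s hs t htB hκ hsW')
    · exact cellExtend_of_card_ne _ hcard
  exact hE.nonempty_first_page hn h₀ h₂ (hF p) (hd p) (hd (p + ε)) _ _ (ψ m₀) (ψ n) (ψ m₂)
    (hs _ hm₀) (hs _ hnq) (hk _ hnq) (hk _ hm₂) (hcomm _ _ hnq) (hcomm _ _ hm₂)

variable [LinearOrder V]

theorem mem_ker_cochainsRes_iff (n : ℤ) (c : Face K n → G) :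
    c ∈ ((cochainsRes G h).f n).hom.ker ↔ ∀ s : Face K n, s.1 ∈ L.faces → c s = 0 := by
  constructor
  · intro hc s hs
    exact congrFun (AddMonoidHom.mem_ker.1 hc) ⟨s.1, hs, s.2.2⟩
  · intro hc
    refine AddMonoidHom.mem_ker.2 (funext fun s => ?_)
    exact hc (faceIncl h s) s.2.1

theorem chains_d_apply (i j : ℤ) (x : (chains K G).X i) :
    ((chains K G).d i j).hom x = cellMap G K.faces incidence i j x := rfl

theorem cochains_d_apply (i j : ℤ) (x : (cochains K G).X i) :
    ((cochains K G).d i j).hom x = cellMap G K.faces (flip incidence) i j x := rfl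

variable (T : MorseTile V)

theorem nonempty_relHomology_addEquiv {m₀ n m₂ : ℤ} (h₀ : m₀ + -1 = n) (h₂ : n + -1 = m₂) :
    Nonempty (relHomology G T.complement_le n ≃+ CellHomology G T.cells incidence m₀ n m₂) := by
  let φ := chainsIncl G T.complement_le
  have hg (m : ℤ) : ∃ e : (cokernel φ).X m ≃+ (Cell T.cells m → G), ∀ x : (chains T.closure G).X m,
      e (((cokernel.π φ).f m).hom x) = cellTransfer G T.closure.faces T.cells m x := by
    refine exists_addEquiv_of_surjective ((cokernel.π φ).f m).hom
      (cellTransfer G T.closure.faces T.cells m) (cokernelπ_f_surjective φ m) (fun y => ⟨_,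
        cellTransfer_cellTransfer_of_subset (fun _ h _ => MorseTile.cells_subset_closure h) y⟩) fun x => ?_
    rw [cokernelπ_f_eq_zero_iff]
    refine Iff.trans ?_ (cellTransfer_eq_zero_iff (fun _ h _ => MorseTile.cells_subset_closure h) _).symm
    refine (mem_range_chainExt_iff G T.complement_le m x).trans (forall_congr' fun s => ?_)
    rw [MorseTile.mem_complement_iff s.2.1, not_not]
  choose e he using hg
  have hd (i j : ℤ) (x : (cokernel φ).X i) :
      e j (((cokernel φ).d i j).hom x) = cellMap G T.cells incidence i j (e i x) := by
    obtain ⟨x, rfl⟩ := cokernelπ_f_surjective φ i x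
    have hcomm : ((cokernel φ).d i j).hom (((cokernel.π φ).f i).hom x) =
        ((cokernel.π φ).f j).hom (((chains T.closure G).d i j).hom x) :=
      congrArg (fun f : (chains T.closure G).X i ⟶ (cokernel φ).X j => f.hom x)
        ((cokernel.π φ).comm i j)
    rw [hcomm, he, he, chains_d_apply]
    -- Inside the closed simplex, every face containing a cell is a cell, so no boundary leads from
    -- a removed face back into the tile.
    refine cellTransfer_cellMap _ _ fun s hs t ht _ hst hn => absurd ⟨?_, ?_⟩ hn
    · have hts := (incidence_ne_zero hst).1
      exact ⟨hs.2, ht.2.1.trans hts, fun h => ht.2.2 (hts.trans h)⟩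
    · exact MorseTile.cells_subset_closure ht
  exact exists_homology_addEquiv (cokernel φ) (i := m₀) (n := n) (k := m₂)
    (ChainComplex.prev ℤ n ▸ by lia) (ChainComplex.next ℤ n ▸ by lia) _ _
    (e m₀) (e n) (e m₂) (hd _ _) (hd _ _)

theorem nonempty_relCohomology_addEquiv {m₀ n m₂ : ℤ} (h₀ : m₀ + 1 = n) (h₂ : n + 1 = m₂) :
    Nonempty (relCohomology G T.complement_le n ≃+
      CellHomology G T.cells (flip incidence) m₀ n m₂) := by
  let φ := cochainsRes G T.complement_le
  have hker (m : ℤ) (x : (kernel φ).X m) (s : Face T.closure m) (hs : s.1 ∉ T.cells) :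
      (show Face T.closure m → G from ((kernel.ι φ).f m).hom x) s = 0 := by
    have hx : ((kernel.ι φ).f m).hom x ∈ (φ.f m).hom.ker := by
      rw [← range_kernelι_f]
      exact ⟨x, rfl⟩
    exact (mem_ker_cochainsRes_iff G T.complement_le m _).1 hx s
      ((MorseTile.mem_complement_iff s.2.1).2 hs)
  let g (m : ℤ) : (kernel φ).X m →+ (Cell T.cells m → G) :=
    (cellTransfer G T.closure.faces T.cells m).comp ((kernel.ι φ).f m).hom
  have hg (m : ℤ) : Function.Bijective (g m) := by
    constructor
    · rw [injective_iff_map_eq_zero]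
      intro x hx
      have := (cellTransfer_eq_zero_iff (fun _ h _ => MorseTile.cells_subset_closure h) _).1 hx
      apply kernelι_f_injective φ m
      rw [map_zero]
      refine funext fun s => ?_
      by_cases hs : s.1 ∈ T.cells
      · exact this s hs
      · exact hker m x s hs
    · intro y
      obtain ⟨x, hx⟩ : cellTransfer G T.cells T.closure.faces m y ∈
          ((kernel.ι φ).f m).hom.range := by
        rw [range_kernelι_f]
        refine (mem_ker_cochainsRes_iff G T.complement_le m _).2 fun s hs => ?_
        exact cellTransfer_of_notMem _ _ ((MorseTile.mem_complement_iff s.2.1).1 hs)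
      refine ⟨x, ?_⟩
      change cellTransfer G T.closure.faces T.cells m (((kernel.ι φ).f m).hom x) = y
      rw [hx]
      exact cellTransfer_cellTransfer_of_subset (fun _ h _ => MorseTile.cells_subset_closure h) y
  have hd (i j : ℤ) (x : (kernel φ).X i) :
      g j (((kernel φ).d i j).hom x) = cellMap G T.cells (flip incidence) i j (g i x) := by
    have hcomm : ((kernel.ι φ).f j).hom (((kernel φ).d i j).hom x) =
        ((cochains T.closure G).d i j).hom (((kernel.ι φ).f i).hom x) :=
      (congrArg (fun f : (kernel φ).X i ⟶ (cochains T.closure G).X j => f.hom x)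
        ((kernel.ι φ).comm i j)).symm
    change cellTransfer G T.closure.faces T.cells j (((kernel.ι φ).f j).hom _) =
      cellMap G T.cells (flip incidence) i j
        (cellTransfer G T.closure.faces T.cells i (((kernel.ι φ).f i).hom x))
    rw [hcomm, cochains_d_apply]
    -- The only offending entries start at a removed face, where a relative cochain vanishes.
    refine cellTransfer_cellMap _ _ fun s hs t ht _ _ hn => ?_
    have hsc : s ∉ T.cells := fun h => hn ⟨h, MorseTile.cells_subset_closure ht⟩
    by_cases hcard : (s.card : ℤ) = i + 1
    · exact (cellExtend_of_mem _ hs hcard).trans (hker i x ⟨s, hs, hcard⟩ hsc)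
    · exact cellExtend_of_card_ne _ hcard
  exact exists_homology_addEquiv (kernel φ) (i := m₀) (n := n) (k := m₂)
    (CochainComplex.prev ℤ n ▸ by lia) (CochainComplex.next ℤ n ▸ by lia) _ _
    (AddEquiv.ofBijective (g m₀) (hg _)) (AddEquiv.ofBijective (g n) (hg _))
    (AddEquiv.ofBijective (g m₂) (hg _)) (hd _ _) (hd _ _)

end Relative

/-! ### Open simplices, barycenters and the points of a tile. -/

section Geometry

open Filter Topology

variable {V : Type u} [Fintype V]

open Classical in
/-- The vertices with nonzero barycentric coordinate: the smallest simplex containing a point. -/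
def carrierFace (x : V → ℝ) : Finset V := Finset.univ.filter fun w => x w ≠ 0

theorem mem_carrierFace {x : V → ℝ} {w : V} : w ∈ carrierFace x ↔ x w ≠ 0 := by
  simp [carrierFace]

theorem carrierFace_nonempty {x : V → ℝ} (hx : x ∈ stdSimplex ℝ V) : (carrierFace x).Nonempty := by
  by_contra h
  rw [Finset.not_nonempty_iff_eq_empty] at h
  have h0 (w : V) : x w = 0 := by
    by_contra hw
    have := mem_carrierFace.2 hw
    simp [h] at this
  have := hx.2
  simp [h0] at this

theorem mem_closedSimplex_iff {s : Finset V} {x : V → ℝ} :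
    x ∈ closedSimplex s ↔ x ∈ stdSimplex ℝ V ∧ carrierFace x ⊆ s := by
  refine and_congr_right fun _ => forall_congr' fun w => ?_
  rw [mem_carrierFace]
  exact not_imp_comm

theorem mem_realization_iff {K : PreAbstractSimplicialComplex V} {x : V → ℝ} :
    x ∈ realization K ↔ x ∈ stdSimplex ℝ V ∧ carrierFace x ∈ K.faces := by
  simp only [realization, Set.mem_iUnion, mem_closedSimplex_iff, exists_prop]
  constructor
  · rintro ⟨s, hs, hx, hxs⟩
    exact ⟨hx, (K.isRelLowerSet_faces hs).2 hxs (carrierFace_nonempty hx)⟩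
  · rintro ⟨hx, hs⟩
    exact ⟨_, hs, hx, subset_rfl⟩

/-- This is the passage from point sets to combinatorics: membership depends only on the open
simplex containing the point, so testing at barycenters suffices. -/
theorem MorseTile.mem_carrier_iff [DecidableEq V] (T : MorseTile V) {x : V → ℝ} :
    x ∈ T.carrier ↔ x ∈ stdSimplex ℝ V ∧ carrierFace x ∈ T.cells := by
  simp only [carrier, Set.mem_sdiff, Set.mem_union, Set.mem_iUnion, mem_closedSimplex_iff,
    exists_prop, not_or, not_exists, not_and, cells, Set.mem_ofPred_eq, and_assoc]
  refine and_congr_right fun hx => and_congr_right fun hS => and_congr ?_ ?_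
  · refine forall_congr' fun w => forall_congr' fun hw => ?_
    simp only [hx, true_imp_iff, Finset.subset_erase, hS, true_and, not_not]
  · simp only [hx, true_imp_iff]

open Classical in
/-- The barycenter of a simplex. -/
def barycenter (s : Finset V) : V → ℝ := fun w => if w ∈ s then (s.card : ℝ)⁻¹ else 0

theorem barycenter_mem_stdSimplex {s : Finset V} (hs : s.Nonempty) :
    barycenter s ∈ stdSimplex ℝ V := by
  classical
  refine ⟨fun w => ?_, ?_⟩
  · unfold barycenter
    split_ifs <;> positivity
  · have : (s.card : ℝ) ≠ 0 := by exact_mod_cast hs.card_pos.ne'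
    simp [barycenter, Finset.sum_ite_mem, this]

theorem carrierFace_barycenter (s : Finset V) : carrierFace (barycenter s) = s := by
  ext w
  rw [mem_carrierFace, barycenter]
  split_ifs with h
  · have : (s.card : ℝ) ≠ 0 := by exact_mod_cast (Finset.card_pos.2 ⟨w, h⟩).ne'
    simp [h, this]
  · simp [h]

/-- Points of the open simplex converging to a given point of the closed simplex. -/
theorem exists_tendsto_carrierFace_eq {s : Finset V} (hs : s.Nonempty) {x : V → ℝ}
    (hx : x ∈ closedSimplex s) : ∃ γ : ℝ → V → ℝ, Tendsto γ (𝓝[>] 0) (𝓝 x) ∧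
      ∀ᶠ t in 𝓝[>] 0, γ t ∈ stdSimplex ℝ V ∧ carrierFace (γ t) = s := by
  -- On the segment towards the barycenter all coordinates of `s` become positive at once.
  refine ⟨fun t => (1 - t) • x + t • barycenter s, ?_, ?_⟩
  · have hcont : Continuous fun t : ℝ => (1 - t) • x + t • barycenter s := by fun_prop
    have := (hcont.tendsto 0).mono_left (nhdsWithin_le_nhds (s := Set.Ioi 0))
    simpa using this
  · filter_upwards [Ioo_mem_nhdsGT (zero_lt_one' ℝ)] with t ht
    refine ⟨convex_stdSimplex ℝ V hx.1 (barycenter_mem_stdSimplex hs) (by linarith [ht.2])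
      ht.1.le (by ring), ?_⟩
    ext w
    rw [mem_carrierFace]
    by_cases hw : w ∈ s
    · have h1 : 0 ≤ (1 - t) * x w := mul_nonneg (by linarith [ht.2]) (hx.1.1 w)
      have h2 : 0 < t * barycenter s w := by
        refine mul_pos ht.1 (lt_of_le_of_ne ((barycenter_mem_stdSimplex hs).1 w) (Ne.symm ?_))
        rwa [← mem_carrierFace, carrierFace_barycenter]
      refine iff_of_true (ne_of_gt ?_) hw
      change 0 < (1 - t) * x w + t * barycenter s w
      linarith
    · refine iff_of_false (not_not.2 ?_) hw
      have h2 : barycenter s w = 0 := by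
        by_contra h
        rw [← ne_eq, ← mem_carrierFace, carrierFace_barycenter] at h
        exact hw h
      simp [hx.2 w hw, h2]

end Geometry

/-! ### The stages of a partial shelling and their filtrations. -/

section Stages

variable {V : Type u} [Fintype V] [LinearOrder V] {K : PreAbstractSimplicialComplex V}
  {τ : MorseTiling K} {q : ℕ}

theorem MorseTiling.notMem_cells (τ : MorseTiling K) {T T' : MorseTile V} (hT : T ∈ τ.tiles)
    (hT' : T' ∈ τ.tiles) (hne : T ≠ T') {s : Finset V} (hs : s ∈ T.cells) : s ∉ T'.cells := by
  intro hs'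
  have hb := barycenter_mem_stdSimplex (MorseTile.nonempty_of_mem_cells hs)
  have h {T : MorseTile V} (hs : s ∈ T.cells) : barycenter s ∈ T.carrier :=
    T.mem_carrier_iff.2 ⟨hb, by rwa [carrierFace_barycenter]⟩
  exact Set.disjoint_left.1 (τ.disjoint T hT T' hT' hne) (h hs) (h hs')

theorem MorseTiling.mem_skeleton_of_mem_cells (τ : MorseTiling K) {T : MorseTile V}
    (hT : T ∈ τ.tiles) {s : Finset V} (hs : s ∈ T.cells) (hq : s.card ≤ q + 1) :
    s ∈ (skeleton K q).faces :=
  ⟨(K.isRelLowerSet_faces (τ.simplex_mem T hT)).2 hs.1 (MorseTile.nonempty_of_mem_cells hs), hq⟩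

namespace MorseTiling.PartialShelling

variable (P : τ.PartialShelling q)

theorem mem_union_iff {p : ℤ} {x : V → ℝ} : x ∈ P.union p ↔ x ∈ stdSimplex ℝ V ∧
    ∃ i : Fin P.length, ((i : ℕ) : ℤ) < p ∧ carrierFace x ∈ (P.tile i).cells := by
  simp only [union, Set.mem_iUnion, Set.mem_ofPred_eq, MorseTile.mem_carrier_iff, exists_prop]
  exact ⟨fun ⟨i, hi, hx, h⟩ => ⟨hx, i, hi, h⟩, fun ⟨hx, i, hi, h⟩ => ⟨i, hi, hx, h⟩⟩

theorem isClosedIn_union (p : ℤ) :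
    IsClosedIn (realization (skeleton K q)) (P.union p ∩ realization (skeleton K q)) := by
  have := P.closed (min p.toNat P.length) (min_le_right _ _)
  have hset : {i : Fin P.length | (i : ℕ) < min p.toNat P.length} =
      {i : Fin P.length | ((i : ℕ) : ℤ) < p} := by
    ext i
    have := i.2
    simp only [Set.mem_ofPred_eq]
    lia
  rw [hset] at this
  exact this

/-- Closedness of the partial unions enters here: a relatively closed set containing an open simplex
of the skeleton contains its closure, so the whole closed simplex lies in `S_p` once its interior
does. -/
theorem mem_stage_iff {p : ℤ} {s : Finset V} : s ∈ (P.stage p).faces ↔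
    s ∈ (skeleton K q).faces ∧
      ∃ i : Fin P.length, ((i : ℕ) : ℤ) < p ∧ s ∈ (P.tile i).cells := by
  refine and_congr_right fun hs => ?_
  have hne : s.Nonempty := ((skeleton K q).isRelLowerSet_faces hs).1
  constructor
  · intro h
    have := P.mem_union_iff.1 (h (mem_closedSimplex_iff.2
      ⟨barycenter_mem_stdSimplex hne, (carrierFace_barycenter s).subset⟩))
    rw [carrierFace_barycenter] at this
    exact this.2
  · rintro hi x hx
    obtain ⟨Z, hZ, hZU⟩ := isClosed_induced_iff.1 (P.isClosedIn_union p).2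
    have hxK : x ∈ realization (skeleton K q) := by
      simp only [realization, Set.mem_iUnion]
      exact ⟨s, hs, hx⟩
    obtain ⟨γ, hγ, hγs⟩ := exists_tendsto_carrierFace_eq hne hx
    have hxZ : x ∈ Z := by
      refine hZ.mem_of_tendsto hγ (hγs.mono fun t ht => ?_)
      have hK : γ t ∈ realization (skeleton K q) := mem_realization_iff.2 ⟨ht.1, by rwa [ht.2]⟩
      have hmem : (⟨γ t, hK⟩ : realization (skeleton K q)) ∈
          ((↑) ⁻¹' (P.union p ∩ realization (skeleton K q)) : Set _) :=
        ⟨P.mem_union_iff.2 ⟨ht.1, by rwa [ht.2]⟩, hK⟩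
      rw [← hZU] at hmem
      exact hmem
    have hmem : (⟨x, hxK⟩ : realization (skeleton K q)) ∈ ((↑) ⁻¹' Z : Set _) := hxZ
    rw [hZU] at hmem
    exact hmem.1

theorem exists_mem_cells {s : Finset V} (hs : s ∈ (skeleton K q).faces) :
    ∃ i, s ∈ (P.tile i).cells := by
  have hb := barycenter_mem_stdSimplex ((skeleton K q).isRelLowerSet_faces hs).1
  have hmem : barycenter s ∈ realization (skeleton K q) :=
    mem_realization_iff.2 ⟨hb, by rwa [carrierFace_barycenter]⟩
  rw [← P.cover] at hmem
  obtain ⟨i, hi⟩ := Set.mem_iUnion.1 hmem.1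
  have := ((P.tile i).mem_carrier_iff.1 hi).2
  rw [carrierFace_barycenter] at this
  exact ⟨i, this⟩

theorem notMem_stage {p : ℤ} (hp : p ≤ 0) (s : Finset V) : s ∉ (P.stage p).faces := by
  intro hs
  obtain ⟨-, i, hi, -⟩ := P.mem_stage_iff.1 hs
  lia

theorem mem_stage_of_length_le {p : ℤ} (hp : P.length ≤ p) {s : Finset V}
    (hs : s ∈ (skeleton K q).faces) : s ∈ (P.stage p).faces := by
  obtain ⟨i, hi⟩ := P.exists_mem_cells hs
  exact P.mem_stage_iff.2 ⟨hs, i, by have := i.2; lia, hi⟩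

theorem stage_mono {p p' : ℤ} (h : p ≤ p') : (P.stage p).faces ⊆ (P.stage p').faces := by
  intro s hs
  obtain ⟨hs, i, hi, hsi⟩ := P.mem_stage_iff.1 hs
  exact P.mem_stage_iff.2 ⟨hs, i, hi.trans_le h, hsi⟩

/-- Tiles are indexed from zero, so tile `i` is what distinguishes stage `i + 1` from stage `i`;
disjointness and injectivity exclude an earlier appearance of its cells. -/
theorem mem_cells_iff (i : Fin P.length) {s : Finset V} (hs : s ∈ (skeleton K q).faces) :
    s ∈ (P.tile i).cells ↔
      s ∈ (P.stage (((i : ℕ) : ℤ) + 1)).faces ∧ s ∉ (P.stage ((i : ℕ) : ℤ)).faces := by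
  constructor
  · refine fun hsi => ⟨P.mem_stage_iff.2 ⟨hs, i, by lia, hsi⟩, fun h => ?_⟩
    obtain ⟨-, j, hj, hsj⟩ := P.mem_stage_iff.1 h
    refine τ.notMem_cells (P.tile_mem i) (P.tile_mem j) (fun hij => ?_) hsi hsj
    have := P.tile_injective hij
    subst this
    lia
  · rintro ⟨h1, h2⟩
    obtain ⟨-, j, hj, hsj⟩ := P.mem_stage_iff.1 h1
    have hji : ¬ ((j : ℕ) : ℤ) < ((i : ℕ) : ℤ) := fun h => h2 (P.mem_stage_iff.2 ⟨hs, j, h, hsj⟩)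
    obtain rfl : j = i := Fin.ext (by lia)
    exact hsj

/-- The tiles outside of a partial shelling have no cells of dimension at most `q`. -/
theorem lt_card_of_mem_cells {T : MorseTile V} (hT : T ∈ τ.tiles) (hTP : T ∉ Set.range P.tile)
    {s : Finset V} (hs : s ∈ T.cells) : q + 1 < s.card := by
  by_contra! hq
  obtain ⟨i, hi⟩ := P.exists_mem_cells (τ.mem_skeleton_of_mem_cells hT hs hq)
  exact τ.notMem_cells hT (P.tile_mem i) (fun h => hTP ⟨i, h.symm⟩) hs hi

theorem cellHomology_subsingleton (G : Type v) [AddCommGroup G] {T : MorseTile V}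
    (hT : T ∈ τ.tiles) (hTP : T ∉ Set.range P.tile) (κ : Finset V → Finset V → ℤ)
    {m₀ n m₂ : ℤ} (hn : n < q) : Subsingleton (CellHomology G T.cells κ m₀ n m₂) := by
  have : IsEmpty (Cell T.cells n) := by
    refine ⟨fun s => ?_⟩
    have h1 := P.lt_card_of_mem_cells hT hTP s.2.1
    have h2 := s.2.2
    lia
  exact MorseTiled.cellHomology_subsingleton κ fun c _ => ⟨0, Subsingleton.elim _ _⟩

variable (G : Type v) [AddCommGroup G]

theorem mem_chainFil_iff (p n : ℤ) (x : (chains (skeleton K q) G).X n) : x ∈ P.chainFil G p n ↔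
    ∀ s : Face (skeleton K q) n, s.1 ∉ (P.stage p).faces →
      (show Face (skeleton K q) n → G from x) s = 0 :=
  mem_range_chainExt_iff G (P.stage_le p) n x

theorem mem_cochainFil_iff (p n : ℤ) (x : (cochains (skeleton K q) G).X n) :
    x ∈ P.cochainFil G p n ↔ ∀ s : Face (skeleton K q) n, s.1 ∈ (P.stage p).faces →
      (show Face (skeleton K q) n → G from x) s = 0 :=
  mem_ker_cochainsRes_iff G (P.stage_le p) n x

theorem homologyFil_eq_cycleFil : P.homologyFil G = cycleFil _ (P.chainFil G) :=
  funext fun p => funext fun n => range_homologyMap _ (chainsIncl G (P.stage_le p)) n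
    fun m => chainExt_injective G (P.stage_le p) m

theorem cohomologyFil_eq_cycleFil : P.cohomologyFil G = cycleFil _ (P.cochainFil G) := by
  refine funext fun p => funext fun n =>
    (range_homologyMap _ (kernel.ι (cochainsRes G (P.stage_le p))) n
      fun m => kernelι_f_injective _ m).trans ?_
  rw [range_kernelι_f]
  rfl

theorem chainFil_mono {p p' : ℤ} (h : p ≤ p') (n : ℤ) : P.chainFil G p n ≤ P.chainFil G p' n := by
  intro x hx
  rw [mem_chainFil_iff] at hx ⊢
  exact fun s hs => hx s fun h' => hs (P.stage_mono h h')

theorem cochainFil_anti {p p' : ℤ} (h : p ≤ p') (n : ℤ) :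
    P.cochainFil G p' n ≤ P.cochainFil G p n := by
  intro x hx
  rw [mem_cochainFil_iff] at hx ⊢
  exact fun s hs => hx s (P.stage_mono h hs)

theorem chainFil_eq_top {p : ℤ} (hp : P.length ≤ p) (n : ℤ) : P.chainFil G p n = ⊤ :=
  (AddSubgroup.eq_top_iff' _).2 fun x => (P.mem_chainFil_iff G p n x).2 fun s hs =>
    absurd (P.mem_stage_of_length_le hp s.2.1) hs

theorem chainFil_eq_bot {p : ℤ} (hp : p ≤ 0) (n : ℤ) : P.chainFil G p n = ⊥ :=
  (AddSubgroup.eq_bot_iff_forall _).2 fun x hx => funext fun s =>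
    (P.mem_chainFil_iff G p n x).1 hx s (P.notMem_stage hp _)

theorem cochainFil_eq_top {p : ℤ} (hp : p ≤ 0) (n : ℤ) : P.cochainFil G p n = ⊤ :=
  (AddSubgroup.eq_top_iff' _).2 fun x => (P.mem_cochainFil_iff G p n x).2 fun _ hs =>
    absurd hs (P.notMem_stage hp _)

theorem cochainFil_eq_bot {p : ℤ} (hp : P.length ≤ p) (n : ℤ) : P.cochainFil G p n = ⊥ :=
  (AddSubgroup.eq_bot_iff_forall _).2 fun x hx => funext fun s =>
    (P.mem_cochainFil_iff G p n x).1 hx s (P.mem_stage_of_length_le hp s.2.1)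

variable {c' : ℤ → ComplexShape (ℤ × ℤ)} {E : SpectralSequence AddCommGrpCat.{max u v} c' 0}

/-- The chain filtration increases, so tile `i` sits at position `i + 1`, where `F (i + 1) / F i` is
its graded piece. -/
theorem nonempty_first_page_chains
    (hE : IsInducedBy (chains (skeleton K q) G) (P.chainFil G) (-1) E) (i : Fin P.length)
    {n : ℤ} (hn : n < q) :
    Nonempty ((E.page 1 zero_le_one).X (((i : ℕ) : ℤ) + 1, n - (((i : ℕ) : ℤ) + 1)) ≃+
      CellHomology G (P.tile i).cells incidence (n + 1) n (n - 1)) := by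
  refine hE.nonempty_first_page_cells (B := (skeleton K q).faces) (q := q)
    G (fun n => AddEquiv.refl (Face (skeleton K q) n → G)) (fun i j x => rfl)
    (fun p => (P.stage p).faces) (fun p n x => P.mem_chainFil_iff G p n x) ?_
    (fun p n => P.chainFil_mono G (by lia) n) (P.tile i).cells ?_ (by ring) (by ring) (by ring)
    ?_ (by lia) (by lia) (by lia)
  · intro p s _ t ht hst hs
    exact mem_of_incidence_ne_zero hs ((skeleton K q).isRelLowerSet_faces ht).1 hst
  · intro s hs
    rw [P.mem_cells_iff i hs, add_neg_cancel_right]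
  · intro s hs hsq
    exact τ.mem_skeleton_of_mem_cells (P.tile_mem i) hs (by exact_mod_cast hsq)

/-- Cochains vanishing on stage `i` are supported on its complement; the piece `F i / F (i + 1)` is
carried by tile `i`, which now sits at position `i`. -/
theorem nonempty_first_page_cochains
    (hE : IsInducedBy (cochains (skeleton K q) G) (P.cochainFil G) 1 E) (i : Fin P.length)
    {n : ℤ} (hn : n < q) :
    Nonempty ((E.page 1 zero_le_one).X (((i : ℕ) : ℤ), n - ((i : ℕ) : ℤ)) ≃+
      CellHomology G (P.tile i).cells (flip incidence) (n - 1) n (n + 1)) := by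
  refine hE.nonempty_first_page_cells (B := (skeleton K q).faces) (q := q)
    G (fun n => AddEquiv.refl (Face (skeleton K q) n → G)) (fun i j x => rfl)
    (fun p => (P.stage p).facesᶜ) (fun p n x => (P.mem_cochainFil_iff G p n x).trans
      (forall_congr' fun s => by rw [Set.mem_compl_iff, not_not]; rfl)) ?_
    (fun p n => P.cochainFil_anti G (by lia) n) (P.tile i).cells ?_ (by ring) (by ring) (by ring)
    ?_ (by lia) (by lia) (by lia)
  · intro p s hs t _ hst hsp htp
    exact hsp (mem_of_incidence_ne_zero htp ((skeleton K q).isRelLowerSet_faces hs).1 hst)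
  · intro s hs
    rw [P.mem_cells_iff i hs, Set.mem_compl_iff, Set.mem_compl_iff, not_not, and_comm]
  · intro s hs hsq
    exact τ.mem_skeleton_of_mem_cells (P.tile_mem i) hs (by exact_mod_cast hsq)

end MorseTiling.PartialShelling

end Stages

theorem isZero_of_addEquiv {X : AddCommGrpCat.{v}} {Y : Type*} [AddCommGroup Y] [Subsingleton Y]
    (e : X ≃+ Y) : IsZero X :=
  have := e.toEquiv.subsingleton
  AddCommGrpCat.isZero_of_subsingleton X

end

end MorseTiled

theorem theorem4p1 {V : Type u} [Fintype V] [LinearOrder V]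
    (K : PreAbstractSimplicialComplex V) (τ : MorseTiled.MorseTiling K) (q : ℕ)
    (hτ : τ.ShellableUpTo q) (P : τ.PartialShelling q) (G : Type v) [AddCommGroup G] :
    (∃ E : CategoryTheory.SpectralSequence AddCommGrpCat.{max u v}
        (fun r => ComplexShape.up' ((-r, r - 1) : ℤ × ℤ)) 0,
      Nonempty (MorseTiled.IsInducedBy (MorseTiled.chains (MorseTiled.skeleton K q) G)
        (P.chainFil G) (-1) E) ∧
      MorseTiled.ConvergesTo (-1) E P.length
        (fun n => (MorseTiled.chains (MorseTiled.skeleton K q) G).homology n)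
        (P.homologyFil G) ∧
      (∀ (i : Fin P.length) (n : ℤ), n < q → (P.tile i).IsCritical →
        Nonempty ((E.page 1 zero_le_one).X (((i : ℕ) : ℤ) + 1, n - (((i : ℕ) : ℤ) + 1)) ≅
          MorseTiled.relHomology G (P.tile i).complement_le n)) ∧
      (∀ (i : Fin P.length) (n : ℤ), n < q → ¬ (P.tile i).IsCritical →
        CategoryTheory.Limits.IsZero
          ((E.page 1 zero_le_one).X (((i : ℕ) : ℤ) + 1, n - (((i : ℕ) : ℤ) + 1)))) ∧
      (∀ p n : ℤ, p < 1 ∨ (P.length : ℤ) < p →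
        CategoryTheory.Limits.IsZero ((E.page 1 zero_le_one).X (p, n - p))) ∧
      (∀ T ∈ τ.tiles, T.IsCritical → T ∉ Set.range P.tile → ∀ n : ℤ, n < q →
        CategoryTheory.Limits.IsZero (MorseTiled.relHomology G T.complement_le n))) ∧
    (∃ E : CategoryTheory.CohomologicalSpectralSequence AddCommGrpCat.{max u v} 0,
      Nonempty (MorseTiled.IsInducedBy (MorseTiled.cochains (MorseTiled.skeleton K q) G)
        (P.cochainFil G) 1 E) ∧
      MorseTiled.ConvergesTo 1 E P.length
        (fun n => (MorseTiled.cochains (MorseTiled.skeleton K q) G).homology n)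
        (P.cohomologyFil G) ∧
      (∀ (i : Fin P.length) (n : ℤ), n < q → (P.tile i).IsCritical →
        Nonempty ((E.page 1 zero_le_one).X (((i : ℕ) : ℤ), n - ((i : ℕ) : ℤ)) ≅
          MorseTiled.relCohomology G (P.tile i).complement_le n)) ∧
      (∀ (i : Fin P.length) (n : ℤ), n < q → ¬ (P.tile i).IsCritical →
        CategoryTheory.Limits.IsZero ((E.page 1 zero_le_one).X (((i : ℕ) : ℤ), n - ((i : ℕ) : ℤ)))) ∧
      (∀ p n : ℤ, p < 0 ∨ (P.length : ℤ) ≤ p →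
        CategoryTheory.Limits.IsZero ((E.page 1 zero_le_one).X (p, n - p))) ∧
      (∀ T ∈ τ.tiles, T.IsCritical → T ∉ Set.range P.tile → ∀ n : ℤ, n < q →
        CategoryTheory.Limits.IsZero (MorseTiled.relCohomology G T.complement_le n))) := by
  open MorseTiled in
  constructor
  · have hF (p n : ℤ) : P.chainFil G (p + -1) n ≤ P.chainFil G p n :=
      P.chainFil_mono G (by lia) n
    have hc' (r : ℤ) : ComplexShape.up' ((-r, r - 1) : ℤ × ℤ) =
        ComplexShape.up' (-1 * r, -1 * (1 - r)) := by
      congr 2 <;> ring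
    obtain ⟨E, ⟨hE⟩⟩ := exists_isInducedBy (C := chains (skeleton K q) G) hF hc'
    refine ⟨E, ⟨hE⟩, ?_, ?_, ?_, ?_, ?_⟩
    · rw [P.homologyFil_eq_cycleFil]
      -- Depth is measured down from the whole complex at `p = N`, so it equals `N - p`; for
      -- cochains it is `p` itself, starting from `0`.
      refine hE.convergesTo hF (fun i => ?_) hc' (by norm_num) P.length P.length ?_ ?_
      · change i + -1 + 1 = i
        ring
      · exact fun p n hp => P.chainFil_eq_top G (by lia) n
      · exact fun p n hp => P.chainFil_eq_bot G (by lia) n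
    · intro i n hn _
      obtain ⟨e⟩ := P.nonempty_first_page_chains G hE i hn
      obtain ⟨e'⟩ := nonempty_relHomology_addEquiv G (P.tile i) (m₀ := n + 1) (n := n)
        (m₂ := n - 1) (by ring) (by ring)
      exact ⟨(e.trans e'.symm).toAddCommGrpIso⟩
    · intro i n hn hT
      obtain ⟨e⟩ := P.nonempty_first_page_chains G hE i hn
      have := (P.tile i).cellHomology_incidence_subsingleton G hT (m₀ := n + 1) (n := n)
        (m₂ := n - 1) (by ring) (by ring)
      exact isZero_of_addEquiv e
    · intro p n hp
      have : Subsingleton ((E.page 1 zero_le_one).X (p, n - p)) := by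
        -- Outside the range `1, …, N` the filtration does not jump: it is zero at `p ≤ 0`, and
        -- already everything at `p - 1` when `p > N`.
        refine subsingleton_of_forall_eq 0 (hE.eq_zero zero_le_one ?_)
        rcases hp with hp | hp
        · rw [P.chainFil_eq_bot G (by lia)]
          exact bot_le
        · rw [P.chainFil_eq_top G (p := p + -1) (by lia)]
          exact le_top
      exact AddCommGrpCat.isZero_of_subsingleton _
    · intro T hT _ hTP n hn
      obtain ⟨e⟩ := nonempty_relHomology_addEquiv G T (m₀ := n + 1) (n := n) (m₂ := n - 1)
        (by ring) (by ring)
      have := P.cellHomology_subsingleton G hT hTP incidence (m₀ := n + 1) (m₂ := n - 1) hn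
      exact isZero_of_addEquiv e
  · have hF (p n : ℤ) : P.cochainFil G (p + 1) n ≤ P.cochainFil G p n :=
      P.cochainFil_anti G (by lia) n
    have hc' (r : ℤ) : ComplexShape.up' ((r, 1 - r) : ℤ × ℤ) =
        ComplexShape.up' (1 * r, 1 * (1 - r)) := by
      congr 2 <;> ring
    obtain ⟨E, ⟨hE⟩⟩ := exists_isInducedBy (C := cochains (skeleton K q) G) hF hc'
    refine ⟨E, ⟨hE⟩, ?_, ?_, ?_, ?_, ?_⟩
    · rw [P.cohomologyFil_eq_cycleFil]
      refine hE.convergesTo hF (fun i => rfl) hc' (by norm_num) 0 P.length ?_ ?_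
      · exact fun p n hp => P.cochainFil_eq_top G (by lia) n
      · exact fun p n hp => P.cochainFil_eq_bot G (by lia) n
    · intro i n hn _
      obtain ⟨e⟩ := P.nonempty_first_page_cochains G hE i hn
      obtain ⟨e'⟩ := nonempty_relCohomology_addEquiv G (P.tile i) (m₀ := n - 1) (n := n)
        (m₂ := n + 1) (by ring) (by ring)
      exact ⟨(e.trans e'.symm).toAddCommGrpIso⟩
    · intro i n hn hT
      obtain ⟨e⟩ := P.nonempty_first_page_cochains G hE i hn
      have := (P.tile i).cellHomology_flip_incidence_subsingleton G hT (m₀ := n - 1) (n := n)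
        (m₂ := n + 1) (by ring) (by ring)
      exact isZero_of_addEquiv e
    · intro p n hp
      have : Subsingleton ((E.page 1 zero_le_one).X (p, n - p)) := by
        refine subsingleton_of_forall_eq 0 (hE.eq_zero zero_le_one ?_)
        rcases hp with hp | hp
        · rw [P.cochainFil_eq_top G (p := p + 1) (by lia)]
          exact le_top
        · rw [P.cochainFil_eq_bot G (by lia)]
          exact bot_le
      exact AddCommGrpCat.isZero_of_subsingleton _
    · intro T hT _ hTP n hn
      obtain ⟨e⟩ := nonempty_relCohomology_addEquiv G T (m₀ := n - 1) (n := n) (m₂ := n + 1)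
        (by ring) (by ring)
      have := P.cellHomology_subsingleton G hT hTP (flip incidence) (m₀ := n - 1) (m₂ := n + 1) hn
      exact isZero_of_addEquiv e
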